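/- **Theorem.** There is a deterministic Turing machine, running in time polynomial in the length of its input, that solves the following problem. *Given* a deterministic and decomposable Boolean circuit $C$ over a finite set of features $X$, an entity $e : X \to \{0,1\}$ and a feature $x \in X$, *compute* the rational number $\mathsf{SHAP}(C, e, x)$ under the uniform distribution on entities, written as a fraction $p/q$ of two binary integers with $q > 0$. Here the notions are as follows. *SHAP-score.* Let $\mathsf{ent}(X)$ be the set of entities, that is, of functions $X \to \{0,1\}$, with the uniform distribution $P(E) = |E| / 2^{|X|}$. For $M : \mathsf{ent}(X) \to \{0,1\}$, $e \in \mathsf{ent}(X)$ and $S \subseteq X$, put $$\mathsf{cw}(e,S) = \{ e' \in \mathsf{ent}(X) : e'(y) = e(y) \text{ for all } y \in S\}, \qquad \phi(M,e,S) = \mathbb{E}\big[ M(e') \mid e' \in \mathsf{cw}(e,S) \big],$$ and for $x \in X$ $$\mathsf{SHAP}(M,e,x) = \sum_{S \subseteq X \setminus \{x\}} \frac{|S|!\,(|X|-|S|-1)!}{|X|!}\,\big( \phi(M,e,S\cup\{x\}) - \phi(M,e,S) \big).$$ *Circuits.* A Boolean circuit $C$ over $X$ is a finite directed acyclic graph whose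 nodes (gates) without incoming edges are labeled by a variable in $X$ or by a constant $0$ or $1$, whose other gates are labeled by $\wedge$, $\vee$ or $\neg$, where a $\neg$-gate has exactly one incoming edge and the fan-in of $\wedge$- and $\vee$-gates is unbounded, and in which exactly one gate, the output gate, has no outgoing edges. For a gate $g$, $C_g$ is the subcircuit of the gates from which there is a (possibly empty) path to $g$, $C_g(e)$ is the value of $g$ on the entity $e$, and $\mathsf{var}(g)$ is the set of variables that label a gate of $C_g$. The circuit $C$ represents the function that maps $e$ to the value $C(e)$ of its output gate, and $\mathsf{SHAP}(C,e,x)$ is the score of that function. The circuit is *deterministic* if for every $\vee$-gate and any two distinct input gates $g_1, g_2$ of it, no entity $e$ satisfies $C_{g_1}(e) = C_{g_2}(e) = 1$. It is *decomposable* if for every $\wedge$-gate and any two distinct input gates $g_1, g_2$ of it, $\mathsf{var}(g_1) \cap \mathsf{var}(g_2) = \emptyset$. *Encoding.* The input is written over a finite alphabet as the list of the values $e(y)$, $y \in X$, with $x$ marked, followed by the list of the gates of $C$ in any order, each with its label and its row of the adjacency matrix of $C$ (variables being given by indicator vectors); this has length polynomial in $|X|$ and the number of gates. -/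

import Mathlib

/-! ### Entities, the uniform distribution, and the SHAP-score -/

section Shap

variable {X : Type} [Fintype X] [DecidableEq X]

/-- The probability of an event under the uniform distribution on the entities `X → Bool`. -/
def uniformProb (E : Finset (X → Bool)) : ℚ :=
  (E.card : ℚ) / 2 ^ Fintype.card X

/-- The set `cw(e, S)` of entities that coincide with `e` on each feature of `S`. -/
def consistentWith (e : X → Bool) (S : Finset X) : Finset (X → Bool) :=
  Finset.univ.filter fun e' => ∀ x ∈ S, e' x = e x

/-- `φ(M, e, S)`: the conditional expectation `𝔼[M(e') | e' ∈ cw(e, S)]` of the classifier `M`,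
under the uniform distribution. The conditioning event contains `e`, so its probability is
positive. -/
def expectedValue (M : (X → Bool) → Bool) (e : X → Bool) (S : Finset X) : ℚ :=
  (∑ e' ∈ consistentWith e S, uniformProb {e'} * (if M e' then 1 else 0)) /
    uniformProb (consistentWith e S)

/-- The SHAP-score of the feature `x` on the entity `e` with respect to the classifier `M`. -/
def SHAP (M : (X → Bool) → Bool) (e : X → Bool) (x : X) : ℚ :=
  ∑ S ∈ (Finset.univ.erase x).powerset,
    ((S.card.factorial : ℚ) * ((Fintype.card X - S.card - 1).factorial : ℚ) /
        ((Fintype.card X).factorial : ℚ)) *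
      (expectedValue M e (insert x S) - expectedValue M e S)

end Shap

/-! ### Boolean circuits -/

/-- The labels of the gates of a Boolean circuit over the variables `X`. -/
inductive GateLabel (X : Type) : Type
  | var (x : X)
  | const (b : Bool)
  | and
  | or
  | not
  deriving DecidableEq

/-- Variable and constant gates, as opposed to logic gates. -/
def GateLabel.IsSource {X : Type} : GateLabel X → Prop
  | .var _ => True
  | .const _ => True
  | _ => False

/-- A Boolean circuit over `X`: a directed acyclic graph on the gates `0, …, size - 1` (numbered in
any order), where `inputs g` is the set of gates with an edge to `g`. The fan-in of `∧`- and
`∨`-gates is unbounded. -/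
structure BoolCircuit (X : Type) where
  size : ℕ
  label : Fin size → GateLabel X
  inputs : Fin size → Finset (Fin size)
  /-- The output gate. -/
  output : Fin size
  /-- There is no directed cycle. -/
  acyclic : ∀ g, ¬ Relation.TransGen (fun h h' => h ∈ inputs h') g g
  /-- The gates without incoming edges are the variable and constant gates. -/
  source_iff : ∀ g, inputs g = ∅ ↔ (label g).IsSource
  /-- A `¬`-gate has exactly one incoming edge. -/
  not_fanin : ∀ g, label g = GateLabel.not → (inputs g).card = 1
  /-- The output gate is the only gate without outgoing edges. -/
  sink_iff : ∀ g, (∀ h, g ∉ inputs h) ↔ g = output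

namespace BoolCircuit

/-- There is an edge from the gate `h` to the gate `g`. -/
def Wire {X : Type} (C : BoolCircuit X) (h g : Fin C.size) : Prop := h ∈ C.inputs g

theorem wire_wellFounded {X : Type} (C : BoolCircuit X) : WellFounded C.Wire := by
  have : IsTrans (Fin C.size) (Relation.TransGen C.Wire) := ⟨fun _ _ _ => Relation.TransGen.trans⟩
  have : Std.Irrefl (Relation.TransGen C.Wire) := ⟨C.acyclic⟩
  exact Subrelation.wf (fun h => Relation.TransGen.single h)
    (Finite.wellFounded_of_trans_of_irrefl (Relation.TransGen C.Wire))

open Classical in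
/-- The value `C_g(e)` of the gate `g` when the circuit is evaluated over the entity `e`. It only
depends on the subcircuit `C_g` of the gates from which there is a path to `g`. -/
noncomputable def eval {X : Type} (C : BoolCircuit X) (e : X → Bool) : Fin C.size → Bool :=
  C.wire_wellFounded.fix fun g val =>
    match C.label g with
    | .var x => e x
    | .const b => b
    | .and => decide (∀ h, ∀ hg : C.Wire h g, val h hg = true)
    | .or => decide (∃ h, ∃ hg : C.Wire h g, val h hg = true)
    | .not => decide (∃ h, ∃ hg : C.Wire h g, val h hg = false)

open Classical in
/-- The evaluation of a gate from the values of its input gates. -/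
theorem eval_eq {X : Type} (C : BoolCircuit X) (e : X → Bool) (g : Fin C.size) :
    C.eval e g =
      match C.label g with
      | .var x => e x
      | .const b => b
      | .and => decide (∀ h ∈ C.inputs g, C.eval e h = true)
      | .or => decide (∃ h ∈ C.inputs g, C.eval e h = true)
      | .not => decide (∃ h ∈ C.inputs g, C.eval e h = false) := by
  rw [eval, WellFounded.fix_eq]
  cases C.label g <;> simp only [Wire, exists_prop] <;> congr

/-- The Boolean classifier represented by the circuit: the value of the output gate. -/
noncomputable def classifier {X : Type} (C : BoolCircuit X) (e : X → Bool) : Bool :=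
  C.eval e C.output

/-- `var(g)`: the variables that label a gate from which there is a (possibly empty) path
to `g`. -/
def vars {X : Type} (C : BoolCircuit X) (g : Fin C.size) : Set X :=
  {x | ∃ h, Relation.ReflTransGen C.Wire h g ∧ C.label h = GateLabel.var x}

/-- Any two distinct input gates of an `∨`-gate are never both true. -/
def Deterministic {X : Type} (C : BoolCircuit X) : Prop :=
  ∀ g, C.label g = GateLabel.or → ∀ g₁ ∈ C.inputs g, ∀ g₂ ∈ C.inputs g, g₁ ≠ g₂ →
    ¬ ∃ e : X → Bool, C.eval e g₁ = true ∧ C.eval e g₂ = true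

/-- Any two distinct input gates of an `∧`-gate depend on disjoint sets of variables. -/
def Decomposable {X : Type} (C : BoolCircuit X) : Prop :=
  ∀ g, C.label g = GateLabel.and → ∀ g₁ ∈ C.inputs g, ∀ g₂ ∈ C.inputs g, g₁ ≠ g₂ →
    Disjoint (C.vars g₁) (C.vars g₂)

end BoolCircuit

/-! ### The computational problem and its encoding -/

/-- An input of the problem: a deterministic and decomposable Boolean circuit over a finite set of
features, an entity and a feature. The features are named `0, …, numFeatures - 1`. -/
structure ShapInput where
  numFeatures : ℕ
  circuit : BoolCircuit (Fin numFeatures)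
  deterministic : circuit.Deterministic
  decomposable : circuit.Decomposable
  entity : Fin numFeatures → Bool
  feature : Fin numFeatures

/-- The (finite) input alphabet. -/
inductive InputSymbol : Type
  | bit (b : Bool)
  | varGate
  | constGate (b : Bool)
  | andGate
  | orGate
  | notGate
  | endEntity
  deriving DecidableEq, Fintype

/-- The symbol for the kind of a gate. -/
def GateLabel.symbol {X : Type} : GateLabel X → InputSymbol
  | .var _ => .varGate
  | .const b => .constGate b
  | .and => .andGate
  | .or => .orGate
  | .not => .notGate

/-- A gate is written as its kind, a bit telling whether it is the output gate, the indicator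
vector of its variable (all zero if it is not a variable gate), and its row of the adjacency
matrix. -/
def BoolCircuit.encodeGate {n : ℕ} (C : BoolCircuit (Fin n)) (g : Fin C.size) : List InputSymbol :=
  (C.label g).symbol :: InputSymbol.bit (decide (g = C.output)) ::
    (List.ofFn (fun y : Fin n => InputSymbol.bit (decide (C.label g = GateLabel.var y))) ++
      List.ofFn (fun h : Fin C.size => InputSymbol.bit (decide (h ∈ C.inputs g))))

/-- An input is written as the bits of the entity, each followed by a mark for the given feature,
then the gates one after the other. With `n` features and `m` gates its length is
`2 * n + 1 + m * (2 + n + m)`, which is polynomially related to the length of any other usual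
encoding (such as adjacency lists with binary indices). -/
def ShapInput.encode (i : ShapInput) : List InputSymbol :=
  (List.ofFn fun y : Fin i.numFeatures =>
      [InputSymbol.bit (i.entity y), InputSymbol.bit (decide (y = i.feature))]).flatten ++
    InputSymbol.endEntity ::
      (List.ofFn fun g : Fin i.circuit.size => i.circuit.encodeGate g).flatten

/-- A fraction `p / q` is written as the sign of `p`, the binary digits of `|p|` (least significant
first), the separator `none`, and the binary digits of `q`. -/
def encodeFraction (r : ℤ × ℕ) : List (Option Bool) :=
  some (decide (r.1 < 0)) :: (r.1.natAbs.bits.map some ++ none :: r.2.bits.map some)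

/-!
The SHAP-score is the integral over `0 ≤ V ≤ 1 / 2` of the difference of two probabilities that the
circuit is true. In both of them the features are independent and agree with the entity with
probability `1 - V`, except that the given feature surely agrees in the first one and surely
disagrees in the second. Indeed, write `1 - V = (1 - 2 * V) + V`: with probability `1 - 2 * V` a
feature is put into `S`, otherwise it is uniform, and the integral of
`(1 - 2 * V) ^ s * (2 * V) ^ (n - s - 1)` is half the weight of the sets `S` of size `s`. The other
factor `1 / 2` arises because `φ(S)` is the mean of the two expectations in which the given feature
agrees and disagrees.

By determinism and decomposability the two probabilities, which are polynomials in `V` of degree at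
most `n`, are computed gate by gate, with sums at `∨`, products at `∧` and `1 - p` at `¬`. Updating
all gates simultaneously as often as there are gates avoids a topological sort. All integers are
packed into words of a fixed polynomial width, so every loop repeats a number of times that depends
only on the length of the input, and a Turing machine can run such loops by counting.
-/

/-! ### Loop programs and their execution by Turing machines -/

open Function Turing StateTransition

/-- Programs on the stacks `K` over the alphabet `Γ`. The only loop construct repeats its body a
number of times that is fixed for the whole run, so programs with a polynomial bound on that number
run in polynomial time. -/
inductive LoopProgram (K Γ : Type) : Type
  | skip
  | push (k : K) (a : Γ)
  | pop (k : K) (f : Option Γ → LoopProgram K Γ)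
  | seq (c d : LoopProgram K Γ)
  | loop (c : LoopProgram K Γ)

namespace LoopProgram

section Semantics

variable {K Γ : Type}

/-- The effect of a program on the stacks, where loops are repeated `N` times. -/
def run [DecidableEq K] (N : ℕ) : LoopProgram K Γ → (K → List Γ) → K → List Γ
  | skip, s => s
  | push k a, s => update s k (a :: s k)
  | pop k f, s => (f (s k).head?).run N (update s k (s k).tail)
  | seq c d, s => d.run N (c.run N s)
  | loop c, s => (c.run N)^[N] s

/-- The nesting depth of the loops. -/
def depth [Fintype Γ] : LoopProgram K Γ → ℕ
  | skip => 0
  | push _ _ => 0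
  | pop _ f => Finset.univ.sup fun o => (f o).depth
  | seq c d => max c.depth d.depth
  | loop c => c.depth + 1

/-- A bound for the number of steps, in terms of the number of repetitions of the loops. -/
noncomputable def time [Fintype Γ] : LoopProgram K Γ → Polynomial ℕ
  | skip => 1
  | push _ _ => 1
  | pop _ f => 1 + ∑ o, (f o).time
  | seq c d => c.time + d.time
  | loop c => Polynomial.X * (1 + c.time) + 1 + (Polynomial.X + 1)

theorem time_branch_le [Fintype Γ] (k : K) (f : Option Γ → LoopProgram K Γ) (o : Option Γ)
    (N : ℕ) : 1 + (f o).time.eval N ≤ (pop k f).time.eval N := by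
  simp only [time, Polynomial.eval_add, Polynomial.eval_one, Polynomial.eval_finsetSum]
  gcongr
  exact Finset.single_le_sum (f := fun o => (f o).time.eval N) (fun _ _ => Nat.zero_le _)
    (Finset.mem_univ o)

theorem length_run_le [DecidableEq K] [Fintype Γ] (N : ℕ) :
    ∀ (c : LoopProgram K Γ) (s : K → List Γ) (k : K),
      (c.run N s k).length ≤ (s k).length + c.time.eval N
  | .skip, s, k => Nat.le_add_right _ _
  | .push k' a, s, k => by
    by_cases h : k = k'
    · subst h; simp [run, time]
    · simp [run, h]
  | .pop k' f, s, k => by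
    have htail : (update s k' (s k').tail k).length ≤ (s k).length := by
      by_cases h : k = k'
      · subst h; simp
      · simp [h]
    have := time_branch_le k' f (s k').head? N
    have := length_run_le N (f (s k').head?) (update s k' (s k').tail) k
    rw [run]
    omega
  | .seq c d, s, k => by
    have := length_run_le N c s k
    have := length_run_le N d (c.run N s) k
    simp only [run, time, Polynomial.eval_add]
    omega
  | .loop c, s, k => by
    have hiter : ∀ n, ((c.run N)^[n] s k).length ≤ (s k).length + n * c.time.eval N := by
      intro n
      induction n with
      | zero => simp
      | succ n ih =>
        rw [iterate_succ_apply', Nat.succ_mul]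
        have := length_run_le N c ((c.run N)^[n] s) k
        omega
    refine (hiter N).trans ?_
    simp only [time, Polynomial.eval_add, Polynomial.eval_mul, Polynomial.eval_X,
      Polynomial.eval_one, Nat.mul_add]
    omega

/-- Replaces every loop by `d` nested ones. -/
def blowup (d : ℕ) : LoopProgram K Γ → LoopProgram K Γ
  | skip => skip
  | push k a => push k a
  | pop k f => pop k fun o => (f o).blowup d
  | seq c c' => seq (c.blowup d) (c'.blowup d)
  | loop c => loop^[d] (c.blowup d)

theorem run_iterate_loop [DecidableEq K] (N : ℕ) (c : LoopProgram K Γ) (d : ℕ) :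
    (loop^[d] c).run N = (c.run N)^[N ^ d] := by
  induction d with
  | zero => rw [pow_zero, iterate_zero_apply, iterate_one]
  | succ d ih =>
    rw [iterate_succ_apply', pow_succ, iterate_mul, ← ih]
    rfl

theorem run_blowup [DecidableEq K] (N d : ℕ) :
    ∀ c : LoopProgram K Γ, (c.blowup d).run N = c.run (N ^ d)
  | skip | push _ _ => rfl
  | pop k f => funext fun s => congrFun (run_blowup N d (f (s k).head?)) _
  | seq c c' => by
    funext s
    rw [blowup, run, run, run_blowup N d c, run_blowup N d c']
  | loop c => by
    rw [blowup, run_iterate_loop, run_blowup N d c]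
    rfl

end Semantics

section Position

variable {K Γ : Type}

/-- The positions in a program, which serve as the labels of the machine that executes it. A loop
runs its body at `down`, and restores its counter at `up`. -/
inductive Pos : LoopProgram K Γ → Type
  | skip : Pos skip
  | push (k : K) (a : Γ) : Pos (push k a)
  | pop (k : K) (f : Option Γ → LoopProgram K Γ) : Pos (pop k f)
  | branch (k : K) {f : Option Γ → LoopProgram K Γ} (o : Option Γ) (p : Pos (f o)) : Pos (pop k f)
  | fst {c : LoopProgram K Γ} (d : LoopProgram K Γ) (p : Pos c) : Pos (seq c d)
  | snd (c : LoopProgram K Γ) {d : LoopProgram K Γ} (p : Pos d) : Pos (seq c d)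
  | down (c : LoopProgram K Γ) : Pos (loop c)
  | up (c : LoopProgram K Γ) : Pos (loop c)
  | body {c : LoopProgram K Γ} (p : Pos c) : Pos (loop c)

theorem finite_pos [Finite Γ] : ∀ c : LoopProgram K Γ, Finite c.Pos
  | skip => Finite.of_surjective (fun _ : Unit => Pos.skip) fun p => by
      cases p; exact ⟨(), rfl⟩
  | push k a => Finite.of_surjective (fun _ : Unit => Pos.push k a) fun p => by
      cases p; exact ⟨(), rfl⟩
  | pop k f =>
    have := fun o => (f o).finite_pos
    Finite.of_surjective
      (fun q : Option (Σ o, (f o).Pos) => q.elim (Pos.pop k f) fun p => Pos.branch k p.1 p.2)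
      fun p => by
        cases p with
        | pop => exact ⟨none, rfl⟩
        | branch _ o p => exact ⟨some ⟨o, p⟩, rfl⟩
  | seq c d =>
    have := c.finite_pos
    have := d.finite_pos
    Finite.of_surjective (Sum.elim (Pos.fst d) (Pos.snd c)) fun p => by
      cases p with
      | fst _ p => exact ⟨.inl p, rfl⟩
      | snd _ p => exact ⟨.inr p, rfl⟩
  | loop c =>
    have := c.finite_pos
    Finite.of_surjective
      (Sum.elim (fun b : Bool => cond b (Pos.down c) (Pos.up c)) Pos.body) fun p => by
      cases p with
      | down => exact ⟨.inl true, rfl⟩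
      | up => exact ⟨.inl false, rfl⟩
      | body p => exact ⟨.inr p, rfl⟩

/-- The initial position. -/
def entry : ∀ c : LoopProgram K Γ, c.Pos
  | skip => .skip
  | push k a => .push k a
  | pop k f => .pop k f
  | seq c d => .fst d c.entry
  | loop c => .down c

end Position

/-- The stacks of the machine that executes a program on the stacks `K`. Besides those it has an
input and an output stack, and two stacks `yard j true` and `yard j false` for each loop depth `j`,
which hold the remaining and the completed repetitions of the loop of that depth in unary. -/
inductive Stk (K : Type) (D : ℕ) : Type
  | inp
  | out
  | reg (k : K)
  | yard (j : Fin (D + 1)) (b : Bool)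
  deriving DecidableEq, Fintype

/-- The alphabets of the stacks of the machine. -/
@[reducible] def Alph {K : Type} {D : ℕ} (Γ₀ Γ Δ : Type) : Stk K D → Type
  | .inp => Γ₀
  | .out => Δ
  | _ => Γ

section Machine

variable {K Γ₀ Γ Δ : Type} {D : ℕ}

/-- The contents of all stacks of the machine. -/
def contents (i : List Γ₀) (o : List Δ) (s : K → List Γ) (y : Fin (D + 1) → Bool → List Γ) :
    ∀ k : Stk K D, List (Alph Γ₀ Γ Δ k)
  | .inp => i
  | .out => o
  | .reg k => s k
  | .yard j b => y j b

section Update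

variable [DecidableEq K] (i : List Γ₀) (o : List Δ) (s : K → List Γ)
  (y : Fin (D + 1) → Bool → List Γ)

theorem update_contents_inp (l : List Γ₀) :
    update (contents i o s y) (.inp : Stk K D) l = contents l o s y := by
  funext k
  cases k <;> simp [contents]

theorem update_contents_out (l : List Δ) :
    update (contents i o s y) (.out : Stk K D) l = contents i l s y := by
  funext k
  cases k <;> simp [contents]

theorem update_contents_reg (k : K) (l : List Γ) :
    update (contents i o s y) (.reg k : Stk K D) l = contents i o (update s k l) y := by
  funext k'
  cases k' with
  | reg k' =>
    by_cases h : k' = k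
    · subst h; simp [contents]
    · rw [update_of_ne (by simpa using h)]; simp [contents, h]
  | _ => simp [contents]

theorem update_contents_yard (j : Fin (D + 1)) (b : Bool) (l : List Γ) :
    update (contents i o s y) (.yard j b : Stk K D) l =
      contents i o s (update y j (update (y j) b l)) := by
  funext k'
  cases k' with
  | yard j' b' =>
    by_cases h : j' = j
    · subst h
      by_cases h : b' = b
      · subst h; simp [contents]
      · rw [update_of_ne (by simpa using h)]; simp [contents, h]
    · rw [update_of_ne (by simp [h])]; simp [contents, h]
  | _ => simp [contents]

end Update

variable [Inhabited Γ]

/-- A loop counter with `a` remaining and `b` completed repetitions. -/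
def counter (a b : ℕ) (t : Bool) : List Γ :=
  List.replicate (if t then a else b) default

theorem update_counter_true (a b c : ℕ) :
    update (counter a b : Bool → List Γ) true (List.replicate c default) = counter c b := by
  funext t; cases t <;> simp [counter]

theorem update_counter_false (a b c : ℕ) :
    update (counter a b : Bool → List Γ) false (List.replicate c default) = counter a c := by
  funext t; cases t <;> simp [counter]

/-- The statement at a position of a program, where the positions are embedded in the labels by
`emb` and the program is left to the label `ex`. -/
def stmt [Fintype Γ] (Γ₀ Δ : Type) (D : ℕ) {Λ : Type} :
    ∀ c : LoopProgram K Γ, (c.Pos → Λ) → Λ → c.Pos →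
      TM2.Stmt (Alph Γ₀ Γ Δ : Stk K D → Type) Λ (Option Γ)
  | .skip, _, ex, .skip => .goto fun _ => ex
  | .push k a, _, ex, .push _ _ => .push (.reg k) (fun _ => a) (.goto fun _ => ex)
  | .pop k f, emb, _, .pop _ _ =>
    .pop (.reg k) (fun _ o => o) (.goto fun v => emb (.branch k v (f v).entry))
  | .pop k f, emb, ex, .branch _ o p => stmt Γ₀ Δ D (f o) (fun q => emb (.branch k o q)) ex p
  | .seq c d, emb, _, .fst _ p =>
    stmt Γ₀ Δ D c (fun q => emb (.fst d q)) (emb (.snd c d.entry)) p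
  | .seq c d, emb, ex, .snd _ p => stmt Γ₀ Δ D d (fun q => emb (.snd c q)) ex p
  | .loop c, emb, _, .down _ =>
    .pop (.yard (Fin.ofNat (D + 1) c.depth) true) (fun _ o => o)
      (.branch Option.isSome
        (.push (.yard (Fin.ofNat (D + 1) c.depth) false) (fun _ => (default : Γ))
          (.goto fun _ => emb (.body c.entry)))
        (.goto fun _ => emb (.up c)))
  | .loop c, emb, ex, .up _ =>
    .pop (.yard (Fin.ofNat (D + 1) c.depth) false) (fun _ o => o)
      (.branch Option.isSome
        (.push (.yard (Fin.ofNat (D + 1) c.depth) true) (fun _ => (default : Γ))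
          (.goto fun _ => emb (.up c)))
        (.goto fun _ => ex))
  | .loop c, emb, _, .body p => stmt Γ₀ Δ D c (fun q => emb (.body q)) (emb (.down c)) p

end Machine

section ReachesIn

variable {σ : Type} {f : σ → Option σ} {m n : ℕ} {a b c : σ}

/-- `b` is reached from `a` in at most `n` steps. -/
def ReachesIn (f : σ → Option σ) (n : ℕ) (a b : σ) : Prop :=
  ∃ k ≤ n, (flip bind f)^[k] (some a) = some b

theorem ReachesIn.trans (h : ReachesIn f m a b) (h' : ReachesIn f n b c) :
    ReachesIn f (m + n) a c := by
  obtain ⟨k, hk, e⟩ := h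
  obtain ⟨k', hk', e'⟩ := h'
  exact ⟨k' + k, by omega, by rw [iterate_add_apply, e, e']⟩

theorem ReachesIn.single (h : f a = some b) : ReachesIn f 1 a b :=
  ⟨1, le_rfl, h⟩

theorem ReachesIn.head (h : f a = some b) (h' : ReachesIn f n b c) : ReachesIn f (1 + n) a c :=
  (ReachesIn.single h).trans h'

theorem ReachesIn.mono (h : ReachesIn f m a b) (hmn : m ≤ n) : ReachesIn f n a b :=
  let ⟨k, hk, e⟩ := h
  ⟨k, hk.trans hmn, e⟩

end ReachesIn

section Execution

variable {K Γ₀ Γ Δ Λ : Type} {D : ℕ} [Inhabited Γ] [Fintype Γ] [DecidableEq K]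

section Loop

variable {M : Λ → TM2.Stmt (Alph Γ₀ Γ Δ : Stk K D → Type) Λ (Option Γ)} {c : LoopProgram K Γ}
  {emb : (loop c).Pos → Λ} {ex : Λ} (hM : ∀ p, M (emb p) = stmt Γ₀ Δ D _ emb ex p)
  (i : List Γ₀) (o : List Δ)

include hM

theorem step_up_zero (s : K → List Γ) (v : Option Γ) {y : Fin (D + 1) → Bool → List Γ} {a : ℕ}
    (hy : y (Fin.ofNat (D + 1) c.depth) = counter a 0) :
    TM2.step M ⟨some (emb (.up c)), v, contents i o s y⟩ =
      some ⟨some ex, none, contents i o s y⟩ := by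
  rw [TM2.step, hM, stmt]
  generalize Fin.ofNat (D + 1) c.depth = j at *
  have h : contents i o s y (.yard j false : Stk K D) = [] := by simp [contents, hy, counter]
  have e : update (contents i o s y) (.yard j false : Stk K D) [] = contents i o s y := by
    rw [← h, update_eq_self]
  simp only [TM2.stepAux, h, List.head?_nil, List.tail_nil, e, Option.isSome_none, cond_false]

theorem step_up_succ (s : K → List Γ) (v : Option Γ) {y : Fin (D + 1) → Bool → List Γ} {a b : ℕ}
    (hy : y (Fin.ofNat (D + 1) c.depth) = counter a (b + 1)) :
    TM2.step M ⟨some (emb (.up c)), v, contents i o s y⟩ =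
      some ⟨some (emb (.up c)), some default,
        contents i o s (update y (Fin.ofNat (D + 1) c.depth) (counter (a + 1) b))⟩ := by
  rw [TM2.step, hM, stmt]
  generalize Fin.ofNat (D + 1) c.depth = j at *
  have h : contents i o s y (.yard j false : Stk K D) = default :: List.replicate b default := by
    simp [contents, hy, counter, List.replicate_succ]
  have h' : contents i o s (update y j (counter a b)) (.yard j true : Stk K D) =
      List.replicate a default := by simp [contents, counter]
  simp only [TM2.stepAux, h, List.head?_cons, List.tail_cons, Option.isSome_some, cond_true,
    update_contents_yard]
  simp only [hy, update_counter_false, update_counter_true, h', ← List.replicate_succ, update_self,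
    update_idem]

theorem step_down_zero (s : K → List Γ) (v : Option Γ) {y : Fin (D + 1) → Bool → List Γ} {b : ℕ}
    (hy : y (Fin.ofNat (D + 1) c.depth) = counter 0 b) :
    TM2.step M ⟨some (emb (.down c)), v, contents i o s y⟩ =
      some ⟨some (emb (.up c)), none, contents i o s y⟩ := by
  rw [TM2.step, hM, stmt]
  generalize Fin.ofNat (D + 1) c.depth = j at *
  have h : contents i o s y (.yard j true : Stk K D) = [] := by simp [contents, hy, counter]
  have e : update (contents i o s y) (.yard j true : Stk K D) [] = contents i o s y := by
    rw [← h, update_eq_self]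
  simp only [TM2.stepAux, h, List.head?_nil, List.tail_nil, e, Option.isSome_none, cond_false]

theorem step_down_succ (s : K → List Γ) (v : Option Γ) {y : Fin (D + 1) → Bool → List Γ} {a b : ℕ}
    (hy : y (Fin.ofNat (D + 1) c.depth) = counter (a + 1) b) :
    TM2.step M ⟨some (emb (.down c)), v, contents i o s y⟩ =
      some ⟨some (emb (.body c.entry)), some default,
        contents i o s (update y (Fin.ofNat (D + 1) c.depth) (counter a (b + 1)))⟩ := by
  rw [TM2.step, hM, stmt]
  generalize Fin.ofNat (D + 1) c.depth = j at *
  have h : contents i o s y (.yard j true : Stk K D) = default :: List.replicate a default := by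
    simp [contents, hy, counter, List.replicate_succ]
  have h' : contents i o s (update y j (counter a b)) (.yard j false : Stk K D) =
      List.replicate b default := by simp [contents, counter]
  simp only [TM2.stepAux, h, List.head?_cons, List.tail_cons, Option.isSome_some, cond_true,
    update_contents_yard]
  simp only [hy, update_counter_false, update_counter_true, h', ← List.replicate_succ, update_self,
    update_idem]

theorem reachesIn_up (s : K → List Γ) (b : ℕ) :
    ∀ (a : ℕ) (v : Option Γ) (y : Fin (D + 1) → Bool → List Γ),
      y (Fin.ofNat (D + 1) c.depth) = counter a b →
      ∃ v', ReachesIn (TM2.step M) (b + 1) ⟨some (emb (.up c)), v, contents i o s y⟩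
        ⟨some ex, v',
          contents i o s (update y (Fin.ofNat (D + 1) c.depth) (counter (a + b) 0))⟩ := by
  induction b with
  | zero =>
    intro a v y hy
    refine ⟨none, .single ?_⟩
    rw [step_up_zero hM i o s v hy, add_zero, ← hy, update_eq_self]
  | succ b ih =>
    intro a v y hy
    obtain ⟨v', h⟩ := ih (a + 1) (some default)
      (update y (Fin.ofNat (D + 1) c.depth) (counter (a + 1) b)) (update_self ..)
    refine ⟨v', (ReachesIn.head (step_up_succ hM i o s v hy) ?_).mono (Nat.add_comm 1 (b + 1)).le⟩
    rwa [update_idem, add_assoc, add_comm 1 b] at h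

theorem reachesIn_down {g : (K → List Γ) → K → List Γ} {P : (Fin (D + 1) → Bool → List Γ) → Prop}
    {t : ℕ} (hP : ∀ y a b, P y → P (update y (Fin.ofNat (D + 1) c.depth) (counter a b)))
    (hbody : ∀ v s y, P y → ∃ v', ReachesIn (TM2.step M) t
      ⟨some (emb (.body c.entry)), v, contents i o s y⟩
      ⟨some (emb (.down c)), v', contents i o (g s) y⟩) (a : ℕ) :
    ∀ (b : ℕ) (v : Option Γ) (s : K → List Γ) (y : Fin (D + 1) → Bool → List Γ), P y →
      y (Fin.ofNat (D + 1) c.depth) = counter a b →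
      ∃ v', ReachesIn (TM2.step M) (a * (1 + t) + 1)
        ⟨some (emb (.down c)), v, contents i o s y⟩
        ⟨some (emb (.up c)), v', contents i o (g^[a] s)
          (update y (Fin.ofNat (D + 1) c.depth) (counter 0 (a + b)))⟩ := by
  induction a with
  | zero =>
    intro b v s y _ hy
    refine ⟨none, ?_⟩
    rw [zero_add, ← hy, update_eq_self, zero_mul, zero_add]
    exact .single (step_down_zero hM i o s v hy)
  | succ a ih =>
    intro b v s y hPy hy
    obtain ⟨v', h⟩ := hbody (some default) s _ (hP y a (b + 1) hPy)
    obtain ⟨v'', h'⟩ := ih (b + 1) v' (g s) _ (hP y a (b + 1) hPy) (update_self ..)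
    rw [update_idem, ← add_assoc, add_right_comm] at h'
    refine ⟨v'', (ReachesIn.head (step_down_succ hM i o s v hy) (h.trans h')).mono ?_⟩
    rw [Nat.succ_mul]
    omega

theorem reachesIn_loop {g : (K → List Γ) → K → List Γ} {P : (Fin (D + 1) → Bool → List Γ) → Prop}
    {t : ℕ} (hP : ∀ y a b, P y → P (update y (Fin.ofNat (D + 1) c.depth) (counter a b)))
    (hbody : ∀ v s y, P y → ∃ v', ReachesIn (TM2.step M) t
      ⟨some (emb (.body c.entry)), v, contents i o s y⟩
      ⟨some (emb (.down c)), v', contents i o (g s) y⟩) (N : ℕ) (v : Option Γ) (s : K → List Γ)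
    (y : Fin (D + 1) → Bool → List Γ) (hPy : P y)
    (hy : y (Fin.ofNat (D + 1) c.depth) = counter N 0) :
    ∃ v', ReachesIn (TM2.step M) (N * (1 + t) + 1 + (N + 1))
      ⟨some (emb (.down c)), v, contents i o s y⟩
      ⟨some ex, v', contents i o (g^[N] s) y⟩ := by
  obtain ⟨v', hdown⟩ := reachesIn_down hM i o hP hbody N 0 v s y hPy hy
  obtain ⟨v'', hup⟩ := reachesIn_up hM i o (g^[N] s) N 0 v' _ (update_self _ _ y)
  rw [update_idem, zero_add, ← hy, update_eq_self] at hup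
  exact ⟨v'', hdown.trans hup⟩

end Loop

theorem ofNat_ne_ofNat {j d D : ℕ} (hj : j < d) (hd : d ≤ D) :
    Fin.ofNat (D + 1) j ≠ Fin.ofNat (D + 1) d := by
  intro h
  have h := congrArg Fin.val h
  simp only [Fin.ofNat] at h
  rw [Nat.mod_eq_of_lt (by omega), Nat.mod_eq_of_lt (by omega)] at h
  omega

theorem reachesIn_run (N : ℕ) (i : List Γ₀) (o : List Δ) :
    ∀ (c : LoopProgram K Γ) (_ : c.depth ≤ D) {Λ : Type}
      (M : Λ → TM2.Stmt (Alph Γ₀ Γ Δ : Stk K D → Type) Λ (Option Γ)) (emb : c.Pos → Λ) (ex : Λ)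
      (_ : ∀ p, M (emb p) = stmt Γ₀ Δ D _ emb ex p) (v : Option Γ) (s : K → List Γ)
      (y : Fin (D + 1) → Bool → List Γ)
      (_ : ∀ j < c.depth, y (Fin.ofNat (D + 1) j) = counter N 0),
      ∃ v', ReachesIn (TM2.step M) (c.time.eval N) ⟨some (emb c.entry), v, contents i o s y⟩
        ⟨some ex, v', contents i o (c.run N s) y⟩
  | .skip, _, _, M, emb, ex, hM, v, s, y, _ => by
    refine ⟨v, (ReachesIn.single ?_).mono (by simp [time])⟩
    rw [TM2.step, hM]
    rfl
  | .push k a, _, _, M, emb, ex, hM, v, s, y, _ => by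
    refine ⟨v, (ReachesIn.single ?_).mono (by simp [time])⟩
    rw [TM2.step, hM, entry, stmt]
    simp only [TM2.stepAux, update_contents_reg]
    rfl
  | .pop k f, hD, _, M, emb, ex, hM, v, s, y, hy => by
    have hle : (f (s k).head?).depth ≤ (pop k f).depth :=
      Finset.le_sup (f := fun o => (f o).depth) (Finset.mem_univ _)
    obtain ⟨v', h⟩ := reachesIn_run N i o (f (s k).head?) (hle.trans hD) M
      (fun q => emb (.branch k _ q)) ex (fun p => hM _) (s k).head? (update s k (s k).tail) y
      (fun j hj => hy j (hj.trans_le hle))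
    refine ⟨v', (ReachesIn.head ?_ h).mono (time_branch_le k f _ N)⟩
    rw [TM2.step, hM, entry, stmt]
    simp only [TM2.stepAux, update_contents_reg]
    rfl
  | .seq c d, hD, _, M, emb, ex, hM, v, s, y, hy => by
    obtain ⟨v', h⟩ := reachesIn_run N i o c ((le_max_left _ _).trans hD) M
      (fun q => emb (.fst d q)) (emb (.snd c d.entry)) (fun p => hM _) v s y
      (fun j hj => hy j (hj.trans_le (le_max_left _ _)))
    obtain ⟨v'', h'⟩ := reachesIn_run N i o d ((le_max_right _ _).trans hD) M
      (fun q => emb (.snd c q)) ex (fun p => hM _) v' (c.run N s) y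
      (fun j hj => hy j (hj.trans_le (le_max_right _ _)))
    exact ⟨v'', (h.trans h').mono (by simp [time])⟩
  | .loop c, hD, _, M, emb, ex, hM, v, s, y, hy => by
    obtain ⟨v', h⟩ := reachesIn_loop hM i o
      (P := fun y => ∀ j < c.depth, y (Fin.ofNat (D + 1) j) = counter N 0)
      (fun y a b hy j hj => by
        rw [update_of_ne (ofNat_ne_ofNat hj ((Nat.le_succ _).trans hD)), hy j hj])
      (fun v s y hy => reachesIn_run N i o c ((Nat.le_succ _).trans hD) M
        (fun q => emb (.body q)) (emb (.down c)) (fun p => hM _) v s y hy)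
      N v s y (fun j hj => hy j (hj.trans (Nat.lt_succ_self _))) (hy _ (Nat.lt_succ_self c.depth))
    exact ⟨v', h.mono (by simp [time])⟩

end Execution

section Executor

variable {K Γ₀ Γ Δ : Type} {D : ℕ} [Inhabited Γ]

/-- The labels for reading the input, writing the output and clearing the stacks. -/
inductive Ctl : Type
  | read
  | write
  | clear

instance : Finite Ctl :=
  Finite.of_surjective (fun b : Option Bool => b.elim Ctl.read fun b => cond b .write .clear)
    fun c => by
      cases c
      · exact ⟨none, rfl⟩
      · exact ⟨some true, rfl⟩
      · exact ⟨some false, rfl⟩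

/-- Pops all stacks in a list, and keeps in mind whether there was a nonempty one. -/
def popAll {Λ : Type} (ks : List (Stk K D))
    (q : TM2.Stmt (Alph Γ₀ Γ Δ : Stk K D → Type) Λ (Option Γ)) :
    TM2.Stmt (Alph Γ₀ Γ Δ : Stk K D → Type) Λ (Option Γ) :=
  ks.foldr (fun k q => .pop k (fun v o => if o.isSome then some default else v) q) q

/-- Increments all loop counters in a list. -/
def pushAll {Λ : Type} (js : List (Fin (D + 1)))
    (q : TM2.Stmt (Alph Γ₀ Γ Δ : Stk K D → Type) Λ (Option Γ)) :
    TM2.Stmt (Alph Γ₀ Γ Δ : Stk K D → Type) Λ (Option Γ) :=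
  js.foldr (fun j q => .push (.yard j true) (fun _ => (default : Γ)) q) q

variable [DecidableEq K]

theorem stepAux_popAll {Λ : Type} (q : TM2.Stmt (Alph Γ₀ Γ Δ : Stk K D → Type) Λ (Option Γ))
    (ks : List (Stk K D)) (hks : ks.Nodup) : ∀ (v : Option Γ) (S : ∀ k, List (Alph Γ₀ Γ Δ k)),
    ∃ v', TM2.stepAux (popAll ks q) v S =
        TM2.stepAux q v' (fun k => if k ∈ ks then (S k).tail else S k) ∧
      (v' = none ↔ v = none ∧ ∀ k ∈ ks, S k = []) := by
  induction ks with
  | nil => intro v S; exact ⟨v, by simp [popAll]⟩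
  | cons k ks ih =>
    intro v S
    obtain ⟨hk, hks⟩ := List.nodup_cons.1 hks
    obtain ⟨v', h, hv'⟩ := ih hks (if (S k).head?.isSome then some default else v)
      (update S k (S k).tail)
    refine ⟨v', ?_, ?_⟩
    · rw [popAll, List.foldr_cons, TM2.stepAux, ← popAll, h]
      congr 1
      funext k'
      by_cases e : k' = k
      · subst e; simp [hk]
      · simp [e]
    · rw [hv', List.forall_mem_cons]
      have h : ∀ k' ∈ ks, update S k (S k).tail k' = S k' := fun k' hk' =>
        update_of_ne (by rintro rfl; exact hk hk') _ _
      rw [forall₂_congr fun k' hk' => by rw [h k' hk']]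
      cases S k with
      | nil => simp
      | cons a l => simp

theorem stepAux_pushAll {Λ : Type} (q : TM2.Stmt (Alph Γ₀ Γ Δ : Stk K D → Type) Λ (Option Γ))
    (i : List Γ₀) (o : List Δ) (s : K → List Γ) (js : List (Fin (D + 1))) (hjs : js.Nodup) :
    ∀ (v : Option Γ) (y : Fin (D + 1) → Bool → List Γ) (n : ℕ), (∀ j ∈ js, y j = counter n 0) →
    TM2.stepAux (pushAll js q) v (contents i o s y) = TM2.stepAux q v
      (contents i o s fun j => if j ∈ js then counter (n + 1) 0 else y j) := by
  induction js with
  | nil => intro v y n _; simp [pushAll]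
  | cons j js ih =>
    intro v y n hy
    obtain ⟨hj, hjs⟩ := List.nodup_cons.1 hjs
    rw [pushAll, List.foldr_cons, TM2.stepAux, ← pushAll]
    have h : contents i o s y (.yard j true : Stk K D) = List.replicate n default := by
      simp [contents, hy j (by simp), counter]
    simp only [h, ← List.replicate_succ, update_contents_yard]
    rw [hy j (by simp), update_counter_true, ih hjs _ _ n]
    · congr 2
      funext j'
      by_cases e : j' = j
      · subst e; simp [hj]
      · simp [e]
    · intro j' hj'
      rw [update_of_ne (by rintro rfl; exact hj hj'), hy j' (by simp [hj'])]

variable [Fintype K] [Fintype Γ]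

/-- The statements of the machine that moves its input to the stack `k`, executes `c` and outputs
the stack `k`, where `rd` and `wr` translate the symbols. While reading, it sets all loop counters
to the length of the input. -/
noncomputable def executorStmt (c : LoopProgram K Γ) (k : K) (rd : Γ₀ → Γ) (wr : Γ → Δ) :
    Ctl ⊕ c.Pos → TM2.Stmt (Alph Γ₀ Γ Δ : Stk K c.depth → Type) (Ctl ⊕ c.Pos) (Option Γ)
  | .inl .read =>
    .pop .inp (fun _ o => o.map rd)
      (.branch Option.isSome
        (.push (.reg k) (fun v => v.getD default)
          (pushAll Finset.univ.toList (.goto fun _ => .inl .read)))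
        (.goto fun _ => .inr c.entry))
  | .inl .write =>
    .pop (.reg k) (fun _ o => o)
      (.branch Option.isSome
        (.push .out (fun v => wr (v.getD default)) (.goto fun _ => .inl .write))
        (.goto fun _ => .inl .clear))
  | .inl .clear =>
    .load (fun _ => none)
      (popAll (Finset.univ.erase .out).toList
        (.branch Option.isSome (.goto fun _ => .inl .clear) .halt))
  | .inr p => stmt Γ₀ Δ c.depth c .inr (.inl .write) p

/-- The machine that moves its input to the stack `k`, executes `c` and outputs the stack `k`. -/
noncomputable def executor [Fintype Γ₀] (c : LoopProgram K Γ) (k : K) (rd : Γ₀ → Γ) (wr : Γ → Δ) :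
    FinTM2 :=
  have := c.finite_pos
  { K := Stk K c.depth
    k₀ := .inp
    k₁ := .out
    Γ := Alph Γ₀ Γ Δ
    Λ := Ctl ⊕ c.Pos
    main := .inl .read
    ΛFin := Fintype.ofFinite _
    σ := Option Γ
    initialState := none
    Γk₀Fin := inferInstanceAs (Fintype Γ₀)
    m := executorStmt c k rd wr }

variable (c : LoopProgram K Γ) (k : K) (rd : Γ₀ → Γ) (wr : Γ → Δ)

theorem reachesIn_read (l : List Γ₀) : ∀ (v : Option Γ) (o : List Δ) (s : K → List Γ) (n : ℕ),
    ReachesIn (TM2.step (executorStmt c k rd wr)) (l.length + 1)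
      ⟨some (.inl .read), v, contents l o s fun _ => counter n 0⟩
      ⟨some (.inr c.entry), none, contents [] o (update s k ((l.map rd).reverse ++ s k))
        fun _ => counter (n + l.length) 0⟩ := by
  induction l with
  | nil =>
    intro v o s n
    refine .single ?_
    have h : contents [] o s (fun _ => counter n 0) (.inp : Stk K c.depth) = ([] : List Γ₀) := rfl
    rw [TM2.step, executorStmt]
    simp only [TM2.stepAux, update_contents_inp, h, List.head?_nil, List.tail_nil,
      Option.isSome_none, cond_false, Option.map_none]
    simp
  | cons a l ih =>
    intro v o s n
    have h : contents (a :: l) o s (fun _ => counter n 0) (.inp : Stk K c.depth) = a :: l := rfl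
    have h' : contents l o s (fun _ => counter n 0) (.reg k : Stk K c.depth) = s k := rfl
    have e := ih (some (rd a)) o (update s k (rd a :: s k)) (n + 1)
    rw [update_idem, update_self, add_assoc, add_comm 1] at e
    rw [List.map_cons, List.reverse_cons, List.append_assoc, List.singleton_append,
      List.length_cons]
    refine (ReachesIn.head ?_ e).mono (by omega)
    rw [TM2.step, executorStmt]
    simp only [TM2.stepAux, update_contents_inp, update_contents_reg, h, h', List.head?_cons,
      List.tail_cons, Option.map_some, Option.isSome_some, cond_true, Option.getD_some]
    rw [stepAux_pushAll _ _ _ _ _ (Finset.nodup_toList _) _ _ n (fun _ _ => rfl)]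
    simp

theorem reachesIn_write (l : List Γ) : ∀ (v : Option Γ) (o : List Δ) (s : K → List Γ)
    (y : Fin (c.depth + 1) → Bool → List Γ), s k = l →
    ReachesIn (TM2.step (executorStmt c k rd wr)) (l.length + 1)
      ⟨some (.inl .write), v, contents [] o s y⟩
      ⟨some (.inl .clear), none, contents [] (l.reverse.map wr ++ o) (update s k []) y⟩ := by
  induction l with
  | nil =>
    intro v o s y hs
    refine .single ?_
    have h : contents ([] : List Γ₀) o s y (.reg k : Stk K c.depth) = [] := hs
    rw [TM2.step, executorStmt]
    simp only [TM2.stepAux, update_contents_reg, h, List.head?_nil, List.tail_nil,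
      Option.isSome_none, cond_false]
    simp
  | cons a l ih =>
    intro v o s y hs
    have h : contents ([] : List Γ₀) o s y (.reg k : Stk K c.depth) = a :: l := hs
    have h' : contents ([] : List Γ₀) o (update s k l) y (.out : Stk K c.depth) = o := rfl
    have e := ih (some a) (wr a :: o) (update s k l) y (update_self ..)
    rw [update_idem] at e
    rw [List.reverse_cons, List.map_append, List.append_assoc, List.map_singleton,
      List.singleton_append, List.length_cons]
    refine (ReachesIn.head ?_ e).mono (by omega)
    rw [TM2.step, executorStmt]
    simp only [TM2.stepAux, update_contents_out, update_contents_reg, h, h', List.head?_cons,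
      List.tail_cons, Option.isSome_some, cond_true, Option.getD_some]

theorem step_clear (o : List Δ) (v : Option Γ) (s : K → List Γ)
    (y : Fin (c.depth + 1) → Bool → List Γ) :
    ∃ v', TM2.step (executorStmt c k rd wr) ⟨some (.inl .clear), v, contents [] o s y⟩ =
      some ⟨if v' = none then none else some (.inl .clear), v',
        contents [] o (fun k => (s k).tail) (fun j b => (y j b).tail)⟩ ∧
      (v' = none ↔ (∀ k, s k = []) ∧ ∀ j b, y j b = []) := by
  obtain ⟨v', h, hv'⟩ := stepAux_popAll (Γ₀ := Γ₀) (Γ := Γ) (Δ := Δ) (Λ := Ctl ⊕ c.Pos)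
    (.branch Option.isSome (.goto fun _ => .inl .clear) .halt)
    ((Finset.univ : Finset (Stk K c.depth)).erase .out).toList (Finset.nodup_toList _) none
    (contents [] o s y)
  refine ⟨v', ?_, ?_⟩
  · rw [TM2.step, executorStmt, TM2.stepAux, h]
    have e : (fun k => if k ∈ ((Finset.univ : Finset (Stk K c.depth)).erase .out).toList then
        (contents ([] : List Γ₀) o s y k).tail else contents [] o s y k) =
        contents [] o (fun k => (s k).tail) (fun j b => (y j b).tail) := by
      funext k
      cases k <;> simp [contents]
    rw [e]
    cases v' <;> simp [TM2.stepAux]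
  · rw [hv']
    constructor
    · rintro ⟨-, h⟩
      exact ⟨fun k => h (.reg k) (by simp), fun j b => h (.yard j b) (by simp)⟩
    · rintro ⟨h, h'⟩
      refine ⟨rfl, fun k hk => ?_⟩
      cases k with
      | inp => rfl
      | out => simp at hk
      | reg k => exact h k
      | yard j b => exact h' j b

theorem reachesIn_clear (o : List Δ) (n : ℕ) : ∀ (v : Option Γ) (s : K → List Γ)
    (y : Fin (c.depth + 1) → Bool → List Γ), (∀ k, (s k).length ≤ n) →
    (∀ j b, (y j b).length ≤ n) →
    ReachesIn (TM2.step (executorStmt c k rd wr)) (n + 1)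
      ⟨some (.inl .clear), v, contents [] o s y⟩
      ⟨none, none, contents [] o (fun _ => []) (fun _ _ => [])⟩ := by
  induction n with
  | zero =>
    intro v s y hs hy
    obtain ⟨v', h, hv'⟩ := step_clear c k rd wr o v s y
    simp only [Nat.le_zero, List.length_eq_zero_iff] at hs hy
    obtain rfl : v' = none := hv'.2 ⟨hs, hy⟩
    refine .single (h.trans ?_)
    simp [hs, hy]
  | succ n ih =>
    intro v s y hs hy
    obtain ⟨v', h, hv'⟩ := step_clear c k rd wr o v s y
    by_cases e : v' = none
    · subst e
      obtain ⟨hs, hy⟩ := hv'.1 rfl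
      refine (ReachesIn.single (h.trans ?_)).mono (by omega)
      simp [hs, hy]
    · rw [if_neg e] at h
      refine (ReachesIn.head h (ih v' _ _ (fun k => ?_) (fun j b => ?_))).mono (by omega)
      · simpa using hs k
      · simpa using hy j b

/-- A bound for the number of steps of the machine that executes `c`, in terms of the length of the
input. -/
noncomputable def executorTime (c : LoopProgram K Γ) : Polynomial ℕ :=
  (Polynomial.X + 1) + (c.time + ((Polynomial.X + c.time + 1) + (Polynomial.X + c.time + 1)))

theorem reachesIn_executor (l : List Γ₀) :
    ReachesIn (TM2.step (executorStmt c k rd wr))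
      (c.executorTime.eval l.length)
      ⟨some (.inl .read), none, contents l [] (fun _ => []) fun _ => counter 0 0⟩
      ⟨none, none, contents [] ((c.run l.length (update (fun _ => []) k
        (l.map rd).reverse) k).reverse.map wr) (fun _ => []) (fun _ _ => [])⟩ := by
  set s := update (fun _ => []) k (l.map rd).reverse with hs
  have hlen : ∀ k', (c.run l.length s k').length ≤ l.length + c.time.eval l.length := by
    refine fun k' => (length_run_le _ _ _ _).trans (Nat.add_le_add_right ?_ _)
    by_cases e : k' = k
    · subst e; simp [hs]
    · simp [hs, e]
  have hread := reachesIn_read (Δ := Δ) c k rd wr l none [] (fun _ => []) 0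
  rw [List.append_nil, zero_add, ← hs] at hread
  obtain ⟨v, hrun⟩ := reachesIn_run (D := c.depth) l.length [] [] c le_rfl
    (executorStmt c k rd wr) .inr (.inl .write) (fun _ => rfl) none s
    (fun _ => counter l.length 0) (fun _ _ => rfl)
  have hwrite := (reachesIn_write c k rd wr _ v [] (c.run l.length s)
    (fun _ => counter l.length 0) rfl).mono (Nat.add_le_add_right (hlen k) 1)
  rw [List.append_nil] at hwrite
  have hclear := reachesIn_clear c k rd wr ((c.run l.length s k).reverse.map wr)
    (l.length + c.time.eval l.length) none (update (c.run l.length s) k [])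
    (fun _ => counter l.length 0)
    (fun k' => by
      by_cases e : k' = k
      · subst e; simp
      · simpa [e] using hlen k')
    (fun _ b => by cases b <;> simp [counter])
  simpa [executorTime] using hread.trans (hrun.trans (hwrite.trans hclear))

theorem initList_executor [Fintype Γ₀] (l : List Γ₀) :
    initList (executor c k rd wr) l =
      (⟨some (.inl .read), none, contents l [] (fun _ => []) fun _ => counter 0 0⟩ :
        TM2.Cfg (Alph Γ₀ Γ Δ : Stk K c.depth → Type) (Ctl ⊕ c.Pos) (Option Γ)) := by
  refine congrArg (TM2.Cfg.mk _ _) (funext fun k => ?_)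
  cases k with
  | yard j b => cases b <;> rfl
  | _ => rfl

theorem haltList_executor [Fintype Γ₀] (l : List Δ) :
    haltList (executor c k rd wr) l =
      (⟨none, none, contents [] l (fun _ => []) (fun _ _ => [])⟩ :
        TM2.Cfg (Alph Γ₀ Γ Δ : Stk K c.depth → Type) (Ctl ⊕ c.Pos) (Option Γ)) := by
  refine congrArg (TM2.Cfg.mk _ _) (funext fun k => ?_)
  cases k <;> rfl

end Executor

theorem nonempty_tm2ComputableInPolyTime {K Γ₀ Γ Δ : Type} [Inhabited Γ] [DecidableEq K]
    [Finite K] [Finite Γ] [Finite Γ₀] {c : LoopProgram K Γ} {k : K} {rd : Γ₀ → Γ} {wr : Γ → Δ}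
    {α β : Type} {ea : α → List Γ₀} {eb : β → List Δ} {f : α → β}
    (h : ∀ a, (c.run (ea a).length (update (fun _ => []) k ((ea a).map rd).reverse)
      k).reverse.map wr = eb (f a)) :
    Nonempty (TM2ComputableInPolyTime ea eb f) := by
  have := Fintype.ofFinite K
  have := Fintype.ofFinite Γ
  have := Fintype.ofFinite Γ₀
  refine ⟨{
    tm := executor c k rd wr
    inputAlphabet := Equiv.refl _
    outputAlphabet := Equiv.refl _
    time := c.executorTime
    outputsFun := fun a => ?_ }⟩
  have key := reachesIn_executor c k rd wr (ea a)
  rw [h, ← initList_executor, ← haltList_executor] at key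
  have outputs : ∀ (l : List Γ₀) (l' : List Δ), l = ea a → l' = eb (f a) →
      TM2OutputsInTime (executor c k rd wr) l (some l')
        (c.executorTime.eval (ea a).length) := by
    rintro _ _ rfl rfl
    exact ⟨⟨key.choose, key.choose_spec.2⟩, key.choose_spec.1⟩
  exact outputs _ _ (List.map_id _) (List.map_id _)

end LoopProgram

/-! ### Feasible functions -/

/-- The stacks of the programs that compute feasible functions: `main` holds the arguments and the
values, `aux` and `tmp` are empty between computations, and `io` holds the input and the output of
the whole program. -/
inductive Reg : Type
  | main
  | aux
  | tmp
  | io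
  deriving DecidableEq

instance : Finite Reg :=
  Finite.of_surjective (fun p : Bool × Bool =>
    match p with
    | (false, false) => Reg.main
    | (false, true) => .aux
    | (true, false) => .tmp
    | (true, true) => .io) fun k => by cases k <;> simp

/-- A representation of the elements of `α` by words over the booleans and the letters `A`. The
length of the words only depends on the size parameter `N`, and a loop program can count up to
it. -/
class Layout (A α : Type) where
  word : ℕ → α → List (Bool ⊕ A)
  width : ℕ → ℕ
  length_word : ∀ N a, (word N a).length = width N
  /-- Repeats a program `width` many times. -/
  times : LoopProgram Reg (Bool ⊕ A) → LoopProgram Reg (Bool ⊕ A)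
  run_times : ∀ N c, (times c).run N = (c.run N)^[width N]

namespace Layout

open LoopProgram

variable {A α β : Type}

instance : Layout A Bool where
  word _ b := [.inl b]
  width _ := 1
  length_word _ _ := rfl
  times := id
  run_times _ _ := rfl

instance : Layout A A where
  word _ a := [.inr a]
  width _ := 1
  length_word _ _ := rfl
  times := id
  run_times _ _ := rfl

instance [Layout A α] : Layout A (Option α) where
  word N
    | none => List.replicate (width A α N + 1) (.inl false)
    | some a => .inl true :: word N a
  width N := width A α N + 1
  length_word N
    | none => List.length_replicate
    | some a => congrArg (· + 1) (length_word N a)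
  times c := .seq c (times α c)
  run_times N c := by funext s; rw [run, run_times]; rfl

instance [Layout A α] [Layout A β] : Layout A (α × β) where
  word N p := word N p.1 ++ word N p.2
  width N := width A α N + width A β N
  length_word N p := by rw [List.length_append, length_word, length_word]
  times c := .seq (times β c) (times α c)
  run_times N c := by funext s; rw [run, run_times, run_times, iterate_add_apply]

/-- A list consists of `N` cells, which hold its first elements and are padded with `none`. -/
instance [Layout A α] : Layout A (List α) where
  word N l := ((l.map some).takeD N none).flatMap (word N)
  width N := width A (Option α) N * N
  length_word N l := by
    rw [List.length_flatMap, List.map_congr_left fun a _ => length_word N a, List.map_const',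
      List.sum_replicate, List.takeD_length, smul_eq_mul, mul_comm]
  times c := .loop (times (Option α) c)
  run_times N c := by
    funext s
    rw [run, run_times, iterate_mul]

/-- The elements of `α` are represented by the words for their images in `β`. -/
@[reducible] def ofView [Layout A β] (v : ℕ → α → β) : Layout A α where
  word N a := word N (v N a)
  width := width A β
  length_word N a := length_word N (v N a)
  times := times β
  run_times N c := run_times (α := β) N c

theorem word_prod [Layout A α] [Layout A β] (N : ℕ) (a : α) (b : β) :
    (word N (a, b) : List (Bool ⊕ A)) = word N a ++ word N b :=
  rfl

theorem word_none [Layout A α] (N : ℕ) : (word N (none : Option α) : List (Bool ⊕ A)) =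
    .inl false :: List.replicate (width A α N) (.inl false) :=
  rfl

theorem word_some [Layout A α] (N : ℕ) (a : α) :
    (word N (some a) : List (Bool ⊕ A)) = .inl true :: word N a :=
  rfl

theorem word_list [Layout A α] (N : ℕ) (l : List α) :
    (word N l : List (Bool ⊕ A)) = ((l.map some).takeD N none).flatMap (word N) :=
  rfl

theorem takeD_map_some_succ (N : ℕ) (l : List α) :
    (l.map some).takeD (N + 1) none = l.head? :: (l.tail.map some).takeD N none := by
  cases l <;> rfl

theorem takeD_map_some_take_succ (N : ℕ) (l : List α) :
    ((l.take N).map some).takeD (N + 1) none = (l.map some).takeD N none ++ [none] := by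
  induction N generalizing l with
  | zero => rfl
  | succ N ih =>
    rw [takeD_map_some_succ (N + 1), takeD_map_some_succ N l, List.head?_take,
      if_neg N.succ_ne_zero, ← List.drop_one, List.drop_take,
      Nat.add_sub_cancel, List.drop_one, ih, List.cons_append]

theorem takeD_map_some_eq_append (N : ℕ) (l : List α) :
    ∃ a, (l.map some).takeD (N + 1) none = (l.map some).takeD N none ++ [a] := by
  induction N generalizing l with
  | zero => exact ⟨_, takeD_map_some_succ 0 l⟩
  | succ N ih =>
    obtain ⟨a, ha⟩ := ih l.tail
    exact ⟨a, by rw [takeD_map_some_succ, ha, takeD_map_some_succ N, List.cons_append]⟩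

theorem length_reverse_word [Layout A α] (N : ℕ) (a : α) :
    (word N a : List (Bool ⊕ A)).reverse.length = width A α N := by
  rw [List.length_reverse, length_word]

theorem word_nil [Layout A α] (N : ℕ) :
    (word N ([] : List α) : List (Bool ⊕ A)) =
      List.replicate (width A (List α) N) (.inl false) := by
  rw [word_list, List.map_nil, List.takeD_nil, List.flatMap_replicate]
  exact List.flatten_replicate_replicate.trans (congrArg (List.replicate · _) (mul_comm ..))

theorem word_take [Layout A α] (N : ℕ) (l : List α) :
    (word N (l.take N) : List (Bool ⊕ A)) = word N l := by
  rw [word_list, word_list]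
  congr 1
  obtain ⟨a, ha⟩ := takeD_map_some_eq_append N (l.take N)
  rw [takeD_map_some_take_succ] at ha
  exact (List.append_inj_left' ha rfl).symm

end Layout

/-! ### Programs that move words -/

namespace LoopProgram

open Layout

variable {A α β γ : Type}

/-- The contents of the stacks `main`, `aux`, `tmp` and `io`. -/
def store {Γ : Type} (m x t i : List Γ) : Reg → List Γ
  | .main => m
  | .aux => x
  | .tmp => t
  | .io => i

section Stacks

variable {Γ : Type} (m x t i u : List Γ)

theorem update_store_main : update (store m x t i) .main u = store u x t i := by
  funext k; cases k <;> rfl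

theorem update_store_aux : update (store m x t i) .aux u = store m u t i := by
  funext k; cases k <;> rfl

theorem update_store_tmp : update (store m x t i) .tmp u = store m x u i := by
  funext k; cases k <;> rfl

theorem update_store_io : update (store m x t i) .io u = store m x t u := by
  funext k; cases k <;> rfl

end Stacks

/-- Moves the top of the stack `k` to the stack `k'`. -/
def shift {Γ : Type} (k k' : Reg) : LoopProgram Reg Γ :=
  pop k fun o => o.elim skip (push k')

theorem run_shift {Γ : Type} {k k' : Reg} (h : k ≠ k') (N : ℕ) {s : Reg → List Γ} {a : Γ}
    {w : List Γ} (hs : s k = a :: w) :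
    (shift k k').run N s = update (update s k w) k' (a :: s k') := by
  simp only [shift, run, hs, List.head?_cons, List.tail_cons, Option.elim, update_of_ne h.symm]

theorem iterate_run_shift {Γ : Type} {k k' : Reg} (h : k ≠ k') (N : ℕ) (u w : List Γ)
    {s : Reg → List Γ} (hs : s k = u ++ w) :
    ((shift k k').run N)^[u.length] s = update (update s k w) k' (u.reverse ++ s k') := by
  induction u generalizing s with
  | nil => simp [← show s k = w from hs]
  | cons a u ih =>
    rw [List.length_cons, iterate_succ_apply, run_shift h N (hs.trans (List.cons_append ..)),
      ih (by rw [update_of_ne h, update_self]), update_self, update_comm h.symm, update_idem,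
      update_idem, List.reverse_cons, List.append_assoc, List.singleton_append]

section Moves

variable [Layout A α] {N : ℕ} {u : List (Bool ⊕ A)} (hu : u.length = width A α N)
  (m x t i : List (Bool ⊕ A))
include hu

theorem run_times_shift {k k' : Reg} (h : k ≠ k') {w : List (Bool ⊕ A)}
    {s : Reg → List (Bool ⊕ A)} (hs : s k = u ++ w) :
    (times α (shift k k')).run N s = update (update s k w) k' (u.reverse ++ s k') := by
  rw [run_times, ← hu, iterate_run_shift h N u w hs]

theorem run_shift_main_aux : (times α (shift .main .aux)).run N (store (u ++ m) x t i) =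
    store m (u.reverse ++ x) t i := by
  rw [run_times_shift hu (by decide) rfl, update_store_main, update_store_aux]
  rfl

theorem run_shift_aux_main : (times α (shift .aux .main)).run N (store m (u ++ x) t i) =
    store (u.reverse ++ m) x t i := by
  rw [run_times_shift hu (by decide) rfl, update_store_aux, update_store_main]
  rfl

theorem run_shift_main_tmp : (times α (shift .main .tmp)).run N (store (u ++ m) x t i) =
    store m x (u.reverse ++ t) i := by
  rw [run_times_shift hu (by decide) rfl, update_store_main, update_store_tmp]
  rfl

theorem run_shift_tmp_main : (times α (shift .tmp .main)).run N (store m x (u ++ t) i) =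
    store (u.reverse ++ m) x t i := by
  rw [run_times_shift hu (by decide) rfl, update_store_tmp, update_store_main]
  rfl

theorem run_shift_tmp_aux : (times α (shift .tmp .aux)).run N (store m x (u ++ t) i) =
    store m (u.reverse ++ x) t i := by
  rw [run_times_shift hu (by decide) rfl, update_store_tmp, update_store_aux]
  rfl

theorem run_drop : (times α (pop .main fun _ => skip)).run N (store (u ++ m) x t i) =
    store m x t i := by
  rw [run_times, ← hu]
  clear hu
  induction u with
  | nil => rfl
  | cons a u ih =>
    rw [List.length_cons, iterate_succ_apply, run, update_store_main]
    exact ih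

theorem run_copy : (times α (pop .aux fun o => o.elim skip fun a =>
      seq (push .main a) (push .tmp a))).run N (store m (u ++ x) t i) =
    store (u.reverse ++ m) x (u.reverse ++ t) i := by
  rw [run_times, ← hu]
  clear hu
  induction u generalizing m t with
  | nil => rfl
  | cons a u ih =>
    have hstep : (pop .aux fun o => o.elim skip fun a => seq (push .main a) (push .tmp a)).run N
        (store m (a :: (u ++ x)) t i) = store (a :: m) (u ++ x) (a :: t) i := by
      funext k; cases k <;> rfl
    rw [List.length_cons, iterate_succ_apply, List.cons_append, hstep, ih, List.reverse_cons,
      List.append_assoc, List.append_assoc, List.singleton_append, List.singleton_append]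

end Moves

theorem run_seq {Γ : Type} (N : ℕ) (c d : LoopProgram Reg Γ) (s : Reg → List Γ) :
    (seq c d).run N s = d.run N (c.run N s) :=
  rfl

theorem run_push_main {Γ : Type} (N : ℕ) (a : Γ) (m x t i : List Γ) :
    (push .main a).run N (store m x t i) = store (a :: m) x t i :=
  update_store_main ..

theorem run_pop_main {Γ : Type} (N : ℕ) (f : Option Γ → LoopProgram Reg Γ) (a : Γ)
    (m x t i : List Γ) :
    (pop .main f).run N (store (a :: m) x t i) = (f (some a)).run N (store m x t i) :=
  congrArg ((f (some a)).run N) (update_store_main ..)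

/-- Removes a boolean from `main`, and runs `c` if it is true, otherwise `d`. -/
def branch (c d : LoopProgram Reg (Bool ⊕ A)) : LoopProgram Reg (Bool ⊕ A) :=
  pop .main fun o => match o with
    | some (.inl true) => c
    | _ => d

theorem run_branch (c d : LoopProgram Reg (Bool ⊕ A)) (N : ℕ) (b : Bool)
    (m x t i : List (Bool ⊕ A)) :
    (branch c d).run N (store (.inl b :: m) x t i) =
      (bif b then c else d).run N (store m x t i) := by
  rw [branch, run_pop_main]
  cases b <;> rfl

theorem run_pad [Layout A α] (N : ℕ) (b : Bool ⊕ A) (m x t i : List (Bool ⊕ A)) :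
    (times α (push .main b)).run N (store m x t i) =
      store (List.replicate (width A α N) b ++ m) x t i := by
  rw [run_times]
  induction width A α N with
  | zero => rfl
  | succ n ih => rw [iterate_succ_apply', ih, run_push_main, List.replicate_succ, List.cons_append]

end LoopProgram

open LoopProgram Layout

/-- The functions, depending on the size parameter `N`, that a loop program computes on top of the
stack `main`. -/
def Feasible (A : Type) {α β : Type} [Layout A α] [Layout A β] (f : ℕ → α → β) : Prop :=
  ∃ c : LoopProgram Reg (Bool ⊕ A), ∀ N a m i,
    c.run N (store (word N a ++ m) [] [] i) = store (word N (f N a) ++ m) [] [] i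

namespace Feasible

variable {A α β γ δ ε : Type}
variable [Layout A α] [Layout A β] [Layout A γ] [Layout A δ] [Layout A ε]

theorem of_word_eq {f g : ℕ → α → β} (hf : Feasible A f)
    (h : ∀ N a, (word N (g N a) : List (Bool ⊕ A)) = word N (f N a)) : Feasible A g := by
  obtain ⟨c, hc⟩ := hf
  exact ⟨c, fun N a m i => by rw [hc, h]⟩

theorem of_same_word {f : ℕ → α → β}
    (h : ∀ N a, (word N (f N a) : List (Bool ⊕ A)) = word N a) : Feasible A f :=
  ⟨.skip, fun N a m i => by rw [h]; rfl⟩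

theorem of_eq {f g : ℕ → α → β} (hf : Feasible A f) (h : ∀ N a, f N a = g N a) : Feasible A g :=
  hf.of_word_eq fun N a => by rw [h]

theorem id : Feasible A fun _ (a : α) => a :=
  of_same_word fun _ _ => rfl

theorem comp {g : ℕ → β → γ} {f : ℕ → α → β} (hg : Feasible A g) (hf : Feasible A f) :
    Feasible A fun N a => g N (f N a) := by
  obtain ⟨c, hc⟩ := hg
  obtain ⟨d, hd⟩ := hf
  exact ⟨.seq d c, fun N a m i => by rw [run_seq, hd, hc]⟩

theorem first {f : ℕ → α → β} (hf : Feasible A f) :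
    Feasible A fun N (p : α × γ) => (f N p.1, p.2) := by
  obtain ⟨c, hc⟩ := hf
  refine ⟨c, fun N ⟨a, b⟩ m i => ?_⟩
  rw [word_prod, List.append_assoc, hc, word_prod, List.append_assoc]

theorem drop : Feasible A fun _ (p : α × β) => p.2 := by
  refine ⟨times α (.pop .main fun _ => .skip), fun N ⟨a, b⟩ m i => ?_⟩
  rw [word_prod, List.append_assoc, run_drop (length_word N a)]

theorem swap : Feasible A fun _ (p : α × β) => (p.2, p.1) := by
  refine ⟨.seq (times α (shift .main .aux)) (.seq (times β (shift .main .tmp))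
    (.seq (times α (shift .aux .main)) (times β (shift .tmp .main)))), fun N ⟨a, b⟩ m i => ?_⟩
  rw [run_seq, run_seq, run_seq, word_prod, List.append_assoc, run_shift_main_aux (length_word N a),
    run_shift_main_tmp (length_word N b), run_shift_aux_main (length_reverse_word N a),
    run_shift_tmp_main (length_reverse_word N b), List.reverse_reverse, List.reverse_reverse,
    word_prod, List.append_assoc]

theorem dup : Feasible A fun _ (a : α) => (a, a) := by
  refine ⟨.seq (times α (shift .main .aux)) (.seq
    (times α (.pop .aux fun o => o.elim .skip fun b => .seq (.push .main b) (.push .tmp b)))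
    (.seq (times α (shift .tmp .aux)) (times α (shift .aux .main)))), fun N a m i => ?_⟩
  rw [run_seq, run_seq, run_seq, run_shift_main_aux (length_word N a),
    run_copy (length_reverse_word N a), List.reverse_reverse, run_shift_tmp_aux (length_word N a),
    run_shift_aux_main (length_reverse_word N a), List.reverse_reverse, word_prod,
    List.append_assoc]

theorem bool (b : Bool) : Feasible A fun _ (_ : α) => b := by
  refine ⟨.seq (times α (.pop .main fun _ => .skip)) (.push .main (.inl b)), fun N a m i => ?_⟩
  rw [run_seq, run_drop (length_word N a), run_push_main]
  rfl

theorem letter (x : A) : Feasible A fun _ (_ : α) => x := by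
  refine ⟨.seq (times α (.pop .main fun _ => .skip)) (.push .main (.inr x)), fun N a m i => ?_⟩
  rw [run_seq, run_drop (length_word N a), run_push_main]
  rfl

theorem nil : Feasible A fun _ (_ : α) => ([] : List β) := by
  refine ⟨.seq (times α (.pop .main fun _ => .skip)) (times (List β) (.push .main (.inl false))),
    fun N a m i => ?_⟩
  rw [run_seq, run_drop (length_word N a), run_pad, word_nil]

theorem none : Feasible A fun _ (_ : α) => (Option.none : Option β) := by
  refine ⟨.seq (times α (.pop .main fun _ => .skip))
    (times (Option β) (.push .main (.inl false))), fun N a m i => ?_⟩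
  rw [run_seq, run_drop (length_word N a), run_pad]
  rfl

theorem some : Feasible A fun _ (a : α) => Option.some a :=
  ⟨.push .main (.inl true), fun _ _ _ _ => run_push_main ..⟩

theorem bool_elim {f g : ℕ → α → β} (hf : Feasible A f) (hg : Feasible A g) :
    Feasible A fun N (p : Bool × α) => bif p.1 then f N p.2 else g N p.2 := by
  obtain ⟨c, hc⟩ := hf
  obtain ⟨d, hd⟩ := hg
  refine ⟨branch c d, fun N ⟨b, a⟩ m i => (run_branch ..).trans ?_⟩
  cases b
  · exact hd N a m i
  · exact hc N a m i

theorem letter_elim {f : A → ℕ → α → β} (hf : ∀ x, Feasible A (f x)) :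
    Feasible A fun N (p : A × α) => f p.1 N p.2 := by
  choose c hc using hf
  refine ⟨.pop .main fun o => (o.bind Sum.getRight?).elim .skip c, fun N ⟨x, a⟩ m i =>
    (run_pop_main ..).trans ?_⟩
  exact hc x N a m i

theorem option_elim {f : ℕ → α → γ} {g : ℕ → β × α → γ} (hf : Feasible A f) (hg : Feasible A g) :
    Feasible A fun N (p : Option β × α) => p.1.elim (f N p.2) fun b => g N (b, p.2) := by
  obtain ⟨c, hc⟩ := hf
  obtain ⟨d, hd⟩ := hg
  refine ⟨branch d (.seq (times β (.pop .main fun _ => .skip)) c), fun N ⟨o, a⟩ m i => ?_⟩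
  rw [word_prod, List.append_assoc]
  cases o with
  | none =>
    rw [word_none, List.cons_append, run_branch, cond_false, run_seq,
      run_drop List.length_replicate, hc]
    rfl
  | some b =>
    rw [word_some, List.cons_append, run_branch, cond_true, ← List.append_assoc, ← word_prod, hd]
    rfl

theorem iterate {f : ℕ → α → α} (hf : Feasible A f) : Feasible A fun N a => (f N)^[N] a := by
  obtain ⟨c, hc⟩ := hf
  refine ⟨.loop c, fun N a m i => ?_⟩
  exact (Function.Semiconj.iterate_right (f := fun a => store (word N a ++ m) [] [] i)
    (fun a => (hc N a m i).symm) N a).symm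

theorem cons : Feasible A fun _ (p : α × List α) => p.1 :: p.2 := by
  refine ⟨.seq (.push .main (.inl true)) (.seq (times (List α) (shift .main .aux))
    (.seq (times (Option α) (.pop .main fun _ => .skip)) (times (List α) (shift .aux .main)))),
    fun N ⟨a, l⟩ m i => ?_⟩
  obtain ⟨b, hb⟩ := takeD_map_some_eq_append N (a :: l)
  have hword : .inl true :: (word N (a, l) : List (Bool ⊕ A)) = word N (a :: l) ++ word N b := by
    rw [word_list, ← List.flatMap_singleton (word N) b, ← List.flatMap_append, ← hb,
      takeD_map_some_succ, List.flatMap_cons]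
    rfl
  rw [run_seq, run_seq, run_seq, run_push_main, ← List.cons_append, hword, List.append_assoc,
    run_shift_main_aux (length_word N (a :: l)), run_drop (length_word N b),
    run_shift_aux_main (length_reverse_word N (a :: l)), List.reverse_reverse]

theorem uncons : Feasible A fun N (l : List α) => ((l.take N).head?, (l.take N).tail) := by
  refine ⟨.seq (times (List α) (shift .main .aux)) (.seq
    (times (Option α) (.push .main (.inl false))) (times (List α) (shift .aux .main))),
    fun N l m i => ?_⟩
  have hword : (word N l ++ List.replicate (width A (Option α) N) (.inl false) :
      List (Bool ⊕ A)) = word N ((l.take N).head?, (l.take N).tail) := by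
    rw [word_prod, word_list, word_list, ← List.flatMap_cons, ← takeD_map_some_succ,
      takeD_map_some_take_succ, List.flatMap_append, List.flatMap_singleton]
    rfl
  rw [run_seq, run_seq, run_shift_main_aux (length_word N l), run_pad,
    run_shift_aux_main (length_reverse_word N l), List.reverse_reverse, ← hword, List.append_assoc]

end Feasible

/-! ### Feasible list functions -/

namespace Feasible

variable {A α β γ δ : Type}
variable [Layout A α] [Layout A β] [Layout A γ] [Layout A δ]

theorem pair {f : ℕ → α → β} {g : ℕ → α → γ} (hf : Feasible A f) (hg : Feasible A g) :
    Feasible A fun N a => (f N a, g N a) :=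
  swap.comp (hg.first.comp (swap.comp (hf.first.comp dup)))

theorem snd {f : ℕ → α → β × γ} (hf : Feasible A f) : Feasible A fun N a => (f N a).2 :=
  drop.comp hf

theorem fst {f : ℕ → α → β × γ} (hf : Feasible A f) : Feasible A fun N a => (f N a).1 :=
  (swap.comp hf).snd

theorem cond {c : ℕ → α → Bool} {f g : ℕ → α → β} (hc : Feasible A c) (hf : Feasible A f)
    (hg : Feasible A g) : Feasible A fun N a => bif c N a then f N a else g N a :=
  (bool_elim hf hg).comp (hc.pair id)

theorem take {l : ℕ → α → List β} (hl : Feasible A l) : Feasible A fun N a => (l N a).take N :=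
  hl.of_word_eq fun _ _ => word_take ..

theorem cons' {x : ℕ → α → β} {l : ℕ → α → List β} (hx : Feasible A x) (hl : Feasible A l) :
    Feasible A fun N a => x N a :: l N a :=
  cons.comp (hx.pair hl)

theorem list_elim {l : ℕ → α → List β} {f : ℕ → α → γ} {g : ℕ → α → β → List β → γ}
    (hl : Feasible A l) (hf : Feasible A f)
    (hg : Feasible A fun N (p : α × β × List β) => g N p.1 p.2.1 p.2.2) :
    Feasible A fun N a => match (l N a).take N with
      | [] => f N a
      | b :: t => g N a b t := by
  refine of_eq ((option_elim (A := A) (β := β) (α := List β × α) (f := fun N p => f N p.2)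
    (g := fun N p => g N p.2.2 p.1 p.2.1) (hf.comp id.snd) (hg.comp
      (id.snd.snd.pair (id.fst.pair id.snd.fst)))).comp ((uncons.comp hl).fst.pair
      ((uncons.comp hl).snd.pair id))) fun N a => ?_
  cases (l N a).take N <;> rfl

theorem foldl {l : ℕ → α → List β} {s : ℕ → α → γ} {step : ℕ → α → γ → β → γ}
    (hl : Feasible A l) (hs : Feasible A s)
    (hstep : Feasible A fun N (p : (α × γ) × β) => step N p.1.1 p.1.2 p.2) :
    Feasible A fun N a => ((l N a).take N).foldl (step N a) (s N a) := by
  set body : ℕ → (α × γ) × List β → (α × γ) × List β := fun N p =>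
    match p.2.take N with
    | [] => p
    | b :: t => ((p.1.1, step N p.1.1 p.1.2 b), t) with hbody
  have hfeasible : Feasible A body := id.snd.list_elim id
    ((id.fst.fst.fst.pair (hstep.comp (id.fst.fst.pair id.snd.fst))).pair id.snd.snd)
  have hiterate : ∀ (N k : ℕ) (a : α) (c : γ) (l : List β), l.length ≤ N →
      (body N)^[k] ((a, c), l) = ((a, (l.take k).foldl (step N a) c), l.drop k) := by
    intro N k a
    induction k with
    | zero => intros; rfl
    | succ k ih =>
      intro c l hl
      rw [iterate_succ_apply]
      cases l with
      | nil => simpa [hbody] using ih c [] hl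
      | cons b t =>
        have ht : t.length ≤ N := (Nat.le_succ _).trans hl
        rw [show body N ((a, c), b :: t) = ((a, step N a c b), t) by
          simp only [hbody, List.take_of_length_le hl], ih _ t ht]
        rfl
  refine of_eq (hfeasible.iterate.comp ((id.pair hs).pair hl.take)).fst.snd fun N a => ?_
  rw [hiterate N N a _ _ (List.length_take_le ..), List.take_take, min_self]

theorem reverse {l : ℕ → α → List β} (hl : Feasible A l) :
    Feasible A fun N a => ((l N a).take N).reverse :=
  of_eq (hl.foldl (step := fun _ _ t b => b :: t) nil (id.snd.cons' id.fst.snd)) fun _ _ =>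
    (List.foldl_flip_cons_eq_append'.trans (List.append_nil _))

theorem foldr {l : ℕ → α → List β} {s : ℕ → α → γ} {step : ℕ → α → β → γ → γ}
    (hl : Feasible A l) (hs : Feasible A s)
    (hstep : Feasible A fun N (p : (α × γ) × β) => step N p.1.1 p.2 p.1.2) :
    Feasible A fun N a => ((l N a).take N).foldr (step N a) (s N a) := by
  refine of_eq (hl.reverse.foldl (step := fun N a c b => step N a b c) hs hstep) fun N a => ?_
  rw [List.take_of_length_le (by simp), List.foldl_reverse]

theorem map {l : ℕ → α → List β} {f : ℕ → α → β → γ} (hl : Feasible A l)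
    (hf : Feasible A fun N (p : α × β) => f N p.1 p.2) :
    Feasible A fun N a => (l N a).map (f N a) := by
  refine (hl.foldr (step := fun N a b t => f N a b :: t) nil
    ((hf.comp (id.fst.fst.pair id.snd)).cons' id.fst.snd)).of_word_eq fun N a => ?_
  rw [← word_take N ((l N a).map _), ← List.map_take, ← List.map_eq_foldr]

theorem append {l t : ℕ → α → List β} (hl : Feasible A l) (ht : Feasible A t) :
    Feasible A fun N a => l N a ++ t N a := by
  refine (hl.foldr (step := fun _ _ => List.cons) ht (id.snd.cons' id.fst.snd)).of_word_eq
    fun N a => ?_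
  rw [← word_take N (_ ++ _), ← word_take N (List.foldr ..), List.foldr_cons_eq_append',
    List.take_append, List.take_append, List.take_take, min_self, List.length_take,
    show N - min N (l N a).length = N - (l N a).length by omega]

theorem zip {l : ℕ → α → List β} {t : ℕ → α → List γ} (hl : Feasible A l) (ht : Feasible A t) :
    Feasible A fun N a => (l N a).zip (t N a) := by
  set step : ℕ → α → List γ × List (β × γ) → β → List γ × List (β × γ) := fun N _ s b =>
    match s.1.take N with
    | [] => s
    | c :: t => (t, (b, c) :: s.2) with hstep
  have hfeasible : Feasible A fun N (p : (α × List γ × List (β × γ)) × β) =>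
      step N p.1.1 p.1.2 p.2 := id.fst.snd.fst.list_elim id.fst.snd
    (id.snd.snd.pair ((id.fst.snd.pair id.snd.fst).cons' id.fst.fst.snd.snd))
  have hfoldl : ∀ (N : ℕ) (a : α) (l : List β) (t : List γ) (acc : List (β × γ)), t.length ≤ N →
      (l.foldl (step N a) (t, acc)).2 = (l.zip t).reverse ++ acc := by
    intro N a l
    induction l with
    | nil => intros; rfl
    | cons b l ih =>
      intro t acc ht
      cases t with
      | nil => simpa [hstep] using ih [] acc ht
      | cons c t =>
        rw [List.foldl_cons, show step N a (c :: t, acc) b = (t, (b, c) :: acc) by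
          simp only [hstep, List.take_of_length_le ht], ih _ _ ((Nat.le_succ _).trans ht)]
        simp
  refine (hl.foldl (ht.take.pair nil) hfeasible).snd.reverse.of_word_eq fun N a => ?_
  rw [hfoldl N a _ _ _ (List.length_take_le ..), List.append_nil,
    List.take_of_length_le (by simp), List.reverse_reverse, ← word_take N ((l N a).zip _), List.zip,
    List.take_zipWith]

end Feasible

/-! ### Feasible arithmetic -/

/-- The two's complement representation of `z` modulo `2 ^ N`, most significant digit first. -/
def Layout.bits : ℕ → ℤ → List Bool
  | 0, _ => []
  | N + 1, z => bits N (z / 2) ++ [decide (z % 2 = 1)]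

/-- The first `N` coefficients of a polynomial, constant coefficient first. -/
def Layout.coeffs {R : Type} [Semiring R] (N : ℕ) (p : Polynomial R) : List R :=
  (List.range N).map p.coeff

namespace Layout

variable {A R : Type}

instance : Layout A ℤ := ofView bits

noncomputable instance [Semiring R] [Layout A R] : Layout A (Polynomial R) := ofView coeffs

theorem length_bits (N : ℕ) (z : ℤ) : (bits N z).length = N := by
  induction N generalizing z with
  | zero => rfl
  | succ N ih => rw [bits, List.length_append, ih, List.length_singleton]

theorem bits_eq_of_modEq {N : ℕ} {a b : ℤ} (h : a ≡ b [ZMOD 2 ^ N]) : bits N a = bits N b := by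
  induction N generalizing a b with
  | zero => rfl
  | succ N ih =>
    obtain ⟨c, hc⟩ := h.dvd
    rw [pow_succ, mul_assoc, mul_left_comm] at hc
    have hhalf : a / 2 ≡ b / 2 [ZMOD 2 ^ N] := Int.modEq_iff_dvd.2 ⟨c, by omega⟩
    rw [bits, bits, ih hhalf, show a % 2 = b % 2 by omega]

theorem word_eq_of_modEq {N : ℕ} {a b : ℤ} (h : a ≡ b [ZMOD 2 ^ N]) :
    (word N a : List (Bool ⊕ A)) = word N b :=
  congrArg (word (A := A) (α := List Bool) N) (bits_eq_of_modEq h)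

theorem bits_zero (N : ℕ) : bits N 0 = (List.cons false)^[N] [] := by
  induction N with
  | zero => rfl
  | succ N ih =>
    rw [bits, show (0 : ℤ) / 2 = 0 from rfl, ih]
    clear ih
    induction N with
    | zero => rfl
    | succ N ih =>
      rw [iterate_succ_apply', iterate_succ_apply', List.cons_append, ih]

theorem map_not_bits (N : ℕ) (z : ℤ) : (bits N z).map (!·) = bits N (-z - 1) := by
  induction N generalizing z with
  | zero => rfl
  | succ N ih =>
    rw [bits, List.map_append, ih, bits, show (-z - 1) / 2 = -(z / 2) - 1 by omega,
      List.map_singleton, ← decide_not]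
    exact congrArg (bits N _ ++ [·]) (decide_eq_decide.2 (by omega))

theorem head?_bits {N : ℕ} {z : ℤ} (h : -2 ^ N ≤ z) (h' : z < 2 ^ N) :
    (bits (N + 1) z).head? = some (decide (z < 0)) := by
  induction N generalizing z with
  | zero =>
    obtain rfl | rfl : z = -1 ∨ z = 0 := by omega
    all_goals rfl
  | succ N ih =>
    rw [pow_succ] at h h'
    rw [bits, List.head?_append, ih (by omega) (by omega), Option.some_or]
    exact congrArg some (decide_eq_decide.2 (by omega))

/-- The carry of the sum of three binary digits. -/
def carry (x y c : Bool) : Bool :=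
  bif x then y || c else y && c

/-- One step of a ripple-carry adder, from the carry and the digits computed so far. -/
def addDigit (d : Bool × Bool) (s : Bool × List Bool) : Bool × List Bool :=
  (carry d.1 d.2 s.1, (d.1 ^^ (d.2 ^^ s.1)) :: s.2)

theorem snd_foldr_addDigit (N : ℕ) (a b : ℤ) (c : Bool) (l : List Bool) :
    (((bits N a).zip (bits N b)).foldr addDigit (c, l)).2 =
      bits N (a + b + c.toInt) ++ l := by
  induction N generalizing a b c l with
  | zero => rfl
  | succ N ih =>
    have hdigit : (decide (a % 2 = 1) ^^ (decide (b % 2 = 1) ^^ c)) =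
        decide ((a + b + c.toInt) % 2 = 1) := by
      obtain ha | ha := Int.emod_two_eq_zero_or_one a <;>
        obtain hb | hb := Int.emod_two_eq_zero_or_one b <;>
        cases c <;> simp [Bool.toInt, Int.add_emod, ha, hb]
    have hhalf : a / 2 + b / 2 + (carry (decide (a % 2 = 1)) (decide (b % 2 = 1)) c).toInt =
        (a + b + c.toInt) / 2 := by
      obtain ha | ha := Int.emod_two_eq_zero_or_one a <;>
        obtain hb | hb := Int.emod_two_eq_zero_or_one b <;>
        cases c <;> simp [carry, Bool.toInt, ha, hb] <;> omega
    rw [bits, bits, bits, List.zip_append (by rw [length_bits, length_bits]), List.foldr_append]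
    refine (ih ..).trans ?_
    change bits N (_ + (carry _ _ c).toInt) ++ (_ ^^ (_ ^^ c)) :: l = _
    rw [hhalf, hdigit, List.append_assoc, List.singleton_append]

theorem foldl_bits_modEq (N : ℕ) (a b : ℤ) :
    (bits N a).foldl (fun z c => z + z + bif c then b else 0) 0 ≡ a * b [ZMOD 2 ^ N] := by
  induction N generalizing a with
  | zero => exact Int.modEq_one
  | succ N ih =>
    rw [bits, List.foldl_append, List.foldl_cons, List.foldl_nil, pow_succ']
    have hdouble := ((ih (a / 2)).mul_left' (c := 2)).add_right
      (bif decide (a % 2 = 1) then b else 0)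
    rw [← two_mul]
    suffices h : 2 * (a / 2 * b) + (bif decide (a % 2 = 1) then b else 0) = a * b from
      h ▸ hdouble
    obtain ha | ha := Int.emod_two_eq_zero_or_one a
    · rw [ha, decide_eq_false zero_ne_one, cond_false, add_zero, ← mul_assoc,
        Int.mul_ediv_cancel' (Int.dvd_of_emod_eq_zero ha)]
    · rw [ha, decide_eq_true rfl, cond_true, ← mul_assoc, ← add_one_mul,
        show 2 * (a / 2) + 1 = a by omega]

section Coeffs

variable [Semiring R]

theorem coeffs_succ (N : ℕ) (p : Polynomial R) :
    coeffs (N + 1) p = p.coeff 0 :: coeffs N p.divX := by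
  simp [coeffs, List.range_succ_eq_map, Polynomial.coeff_divX]

theorem take_coeffs_succ (N : ℕ) (p : Polynomial R) :
    (coeffs (N + 1) p).take N = coeffs N p := by
  rw [coeffs, ← List.map_take, List.take_range, min_eq_left N.le_succ, coeffs]

theorem coeffs_congr {N : ℕ} {p q : Polynomial R} (h : ∀ k < N, p.coeff k = q.coeff k) :
    coeffs N p = coeffs N q :=
  List.map_congr_left fun k hk => h k (List.mem_range.1 hk)

theorem word_eq_of_coeff [Layout A R] {N : ℕ} {p q : Polynomial R}
    (h : ∀ k < N, p.coeff k = q.coeff k) : (word N p : List (Bool ⊕ A)) = word N q :=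
  congrArg (word (A := A) (α := List R) N) (coeffs_congr h)

theorem coeff_foldr_coeffs {N k : ℕ} (hk : k < N) (p q : Polynomial R) :
    ((coeffs N p).foldr (fun a r => Polynomial.C a * q + Polynomial.X * r) 0).coeff k =
      (p * q).coeff k := by
  induction N generalizing k p with
  | zero => omega
  | succ N ih =>
    rw [coeffs_succ, List.foldr_cons, Polynomial.coeff_add]
    conv_rhs => rw [← Polynomial.X_mul_divX_add p, add_comm, add_mul, Polynomial.coeff_add,
      mul_assoc]
    cases k with
    | zero => simp
    | succ k => rw [Polynomial.coeff_X_mul, Polynomial.coeff_X_mul, ih (Nat.lt_of_succ_lt_succ hk)]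

end Coeffs

end Layout

/-- A commutative ring with feasible operations. -/
class FeasibleRing (A R : Type) [CommRing R] [Layout A R] : Prop where
  zero {α : Type} [Layout A α] : Feasible A fun _ (_ : α) => (0 : R)
  one {α : Type} [Layout A α] : Feasible A fun _ (_ : α) => (1 : R)
  add : Feasible A fun _ (p : R × R) => p.1 + p.2
  sub : Feasible A fun _ (p : R × R) => p.1 - p.2
  mul : Feasible A fun _ (p : R × R) => p.1 * p.2

namespace Feasible

variable {A α R : Type} [Layout A α]

theorem not {b : ℕ → α → Bool} (hb : Feasible A b) : Feasible A fun N a => !b N a :=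
  of_eq (hb.cond (bool false) (bool true)) fun N a => by cases b N a <;> rfl

theorem and {b c : ℕ → α → Bool} (hb : Feasible A b) (hc : Feasible A c) :
    Feasible A fun N a => b N a && c N a :=
  of_eq (hb.cond hc (bool false)) fun N a => by cases b N a <;> rfl

theorem or {b c : ℕ → α → Bool} (hb : Feasible A b) (hc : Feasible A c) :
    Feasible A fun N a => b N a || c N a :=
  of_eq (hb.cond (bool true) hc) fun N a => by cases b N a <;> rfl

theorem xor {b c : ℕ → α → Bool} (hb : Feasible A b) (hc : Feasible A c) :
    Feasible A fun N a => b N a ^^ c N a :=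
  of_eq (hb.cond hc.not hc) fun N a => by cases b N a <;> simp

section Ring

variable [CommRing R] [Layout A R] [FeasibleRing A R] {f g : ℕ → α → R}

theorem add (hf : Feasible A f) (hg : Feasible A g) : Feasible A fun N a => f N a + g N a :=
  FeasibleRing.add.comp (hf.pair hg)

theorem sub (hf : Feasible A f) (hg : Feasible A g) : Feasible A fun N a => f N a - g N a :=
  FeasibleRing.sub.comp (hf.pair hg)

theorem mul (hf : Feasible A f) (hg : Feasible A g) : Feasible A fun N a => f N a * g N a :=
  FeasibleRing.mul.comp (hf.pair hg)

end Ring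

section Int

variable {f g : ℕ → α → ℤ}

theorem bits (hf : Feasible A f) : Feasible A fun N a => Layout.bits N (f N a) :=
  hf

theorem of_bits (hf : Feasible A fun N a => Layout.bits N (f N a)) : Feasible A f :=
  hf

theorem addDigit : Feasible A fun _ (p : (α × Bool × List Bool) × Bool × Bool) =>
    Layout.addDigit p.2 p.1.2 := by
  have hx : Feasible A fun _ (p : (α × Bool × List Bool) × Bool × Bool) => p.2.1 := id.snd.fst
  have hy : Feasible A fun _ (p : (α × Bool × List Bool) × Bool × Bool) => p.2.2 := id.snd.snd
  have hc : Feasible A fun _ (p : (α × Bool × List Bool) × Bool × Bool) => p.1.2.1 :=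
    id.fst.snd.fst
  exact (hx.cond (hy.or hc) (hy.and hc)).pair ((hx.xor (hy.xor hc)).cons' id.fst.snd.snd)

theorem adder (c : Bool) {l t : ℕ → α → List Bool} (hl : Feasible A l) (ht : Feasible A t)
    (hf : ∀ N a, l N a = Layout.bits N (f N a)) (hg : ∀ N a, t N a = Layout.bits N (g N a)) :
    Feasible A fun N a => f N a + g N a + c.toInt := by
  refine of_bits (of_eq ((hl.zip ht).foldr (s := fun _ _ => (c, []))
    (step := fun _ _ => Layout.addDigit) ((bool c).pair nil) addDigit).snd fun N a => ?_)
  rw [hf, hg, List.take_of_length_le (by simp [length_bits]), snd_foldr_addDigit, List.append_nil]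

theorem zero_int : Feasible A fun _ (_ : α) => (0 : ℤ) :=
  of_bits (of_eq ((iterate (f := fun _ l => false :: l) ((bool false).cons' id)).comp nil)
    fun N _ => (bits_zero N).symm)

theorem mul_int : Feasible A fun _ (p : ℤ × ℤ) => p.1 * p.2 := by
  have hadd : Feasible A fun _ (p : ℤ × ℤ) => p.1 + p.2 :=
    of_eq (adder false id.fst.bits id.snd.bits (fun _ _ => rfl) fun _ _ => rfl)
      fun _ _ => add_zero _
  refine (id.fst.bits.foldl (step := fun _ p z c => z + z + bif c then p.2 else 0) zero_int
    (hadd.comp ((hadd.comp (id.fst.snd.pair id.fst.snd)).pair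
      (id.snd.cond id.fst.fst.snd zero_int)))).of_word_eq fun N p => ?_
  rw [List.take_of_length_le (length_bits N p.1).le]
  exact word_eq_of_modEq (foldl_bits_modEq N p.1 p.2).symm

end Int

end Feasible

namespace FeasibleRing

open Feasible

variable {A R : Type}

instance : FeasibleRing A ℤ where
  zero := zero_int
  one := adder true zero_int.bits zero_int.bits (fun _ _ => rfl) fun _ _ => rfl
  add := of_eq (adder false id.fst.bits id.snd.bits (fun _ _ => rfl) fun _ _ => rfl)
    fun _ _ => add_zero _
  sub := of_eq (adder true id.fst.bits (id.snd.bits.map id.snd.not) (fun _ _ => rfl)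
    fun N p => map_not_bits N p.2) fun _ p => by rw [Bool.toInt_true]; ring
  mul := mul_int

end FeasibleRing

namespace Feasible

variable {A α R : Type} [Layout A α] [CommRing R] [Layout A R]
variable {f g : ℕ → α → Polynomial R} {r : ℕ → α → R}

theorem coeffs (hf : Feasible A f) : Feasible A fun N a => Layout.coeffs N (f N a) :=
  hf

theorem of_coeffs (hf : Feasible A fun N a => Layout.coeffs N (f N a)) : Feasible A f :=
  hf

theorem map_coeffs {op : R → R → R} (hop : Feasible A fun _ (p : R × R) => op p.1 p.2)
    {h : ℕ → α → Polynomial R} (hf : Feasible A f) (hg : Feasible A g)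
    (hh : ∀ N a k, (h N a).coeff k = op ((f N a).coeff k) ((g N a).coeff k)) : Feasible A h := by
  refine of_coeffs (of_eq ((hf.coeffs.zip hg.coeffs).map (f := fun _ _ p => op p.1 p.2)
    (hop.comp id.snd)) fun N a => ?_)
  simp only [Layout.coeffs, List.zip_map', List.map_map, comp_def]
  exact List.map_congr_left fun k _ => (hh N a k).symm

theorem C_add_X_mul (hr : Feasible A r) (hf : Feasible A f) :
    Feasible A fun N a => Polynomial.C (r N a) + Polynomial.X * f N a := by
  refine of_coeffs ((hr.cons' hf.coeffs).of_word_eq fun N a => ?_)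
  have hdivX : (Polynomial.C (r N a) + Polynomial.X * f N a).divX = f N a :=
    Polynomial.ext fun k => by simp [Polynomial.coeff_C_succ]
  rw [← take_coeffs_succ, word_take, coeffs_succ, hdivX]
  simp

variable [FeasibleRing A R]

theorem zero_polynomial : Feasible A fun _ (_ : α) => (0 : Polynomial R) := by
  refine of_coeffs (of_eq ((iterate (f := fun _ l => (0 : R) :: l)
    (FeasibleRing.zero.cons' id)).comp nil) fun N _ => ?_)
  induction N with
  | zero => rfl
  | succ N ih => rw [iterate_succ_apply', ih, coeffs_succ, Polynomial.coeff_zero,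
      Polynomial.divX_zero]

theorem C_mul (hr : Feasible A r) (hf : Feasible A f) :
    Feasible A fun N a => Polynomial.C (r N a) * f N a := by
  refine of_coeffs (of_eq (hf.coeffs.map (f := fun N a s => r N a * s)
    ((hr.comp id.fst).mul id.snd)) fun N a => ?_)
  simp [Layout.coeffs]

theorem X_mul (hf : Feasible A f) : Feasible A fun N a => Polynomial.X * f N a :=
  of_eq (FeasibleRing.zero.C_add_X_mul hf) fun _ _ => by rw [Polynomial.C_0, zero_add]

theorem add_polynomial (hf : Feasible A f) (hg : Feasible A g) :
    Feasible A fun N a => f N a + g N a :=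
  map_coeffs FeasibleRing.add hf hg fun N a => Polynomial.coeff_add (f N a) (g N a)

theorem mul_polynomial : Feasible A fun _ (p : Polynomial R × Polynomial R) => p.1 * p.2 := by
  have hcoeff : Feasible A fun _ (q : ((Polynomial R × Polynomial R) × Polynomial R) × R) => q.2 :=
    id.snd
  have hq : Feasible A fun _ (q : ((Polynomial R × Polynomial R) × Polynomial R) × R) =>
      q.1.1.2 := id.fst.fst.snd
  have hr : Feasible A fun _ (q : ((Polynomial R × Polynomial R) × Polynomial R) × R) => q.1.2 :=
    id.fst.snd
  have hstep : Feasible A fun _ (q : ((Polynomial R × Polynomial R) × Polynomial R) × R) =>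
      Polynomial.C q.2 * q.1.1.2 + Polynomial.X * q.1.2 :=
    (C_mul hcoeff hq).add_polynomial (X_mul hr)
  have hp : Feasible A fun N (p : Polynomial R × Polynomial R) => Layout.coeffs N p.1 := id.fst
  have hfold : Feasible A fun N (p : Polynomial R × Polynomial R) =>
      ((Layout.coeffs N p.1).take N).foldr
        (fun a r => Polynomial.C a * p.2 + Polynomial.X * r) 0 :=
    hp.foldr (step := fun _ (p : Polynomial R × Polynomial R) a (r : Polynomial R) =>
      Polynomial.C a * p.2 + Polynomial.X * r) zero_polynomial hstep
  refine hfold.of_word_eq fun N p => word_eq_of_coeff fun k hk => ?_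
  rw [List.take_of_length_le (by simp [Layout.coeffs]), coeff_foldr_coeffs hk]

end Feasible

instance {A R : Type} [CommRing R] [Layout A R] [FeasibleRing A R] :
    FeasibleRing A (Polynomial R) where
  zero := Feasible.zero_polynomial
  one := Feasible.of_eq (FeasibleRing.one.C_add_X_mul Feasible.zero_polynomial) fun _ _ => by
    rw [mul_zero, add_zero, Polynomial.C_1]
  add := Feasible.add_polynomial Feasible.id.fst Feasible.id.snd
  sub := .map_coeffs FeasibleRing.sub Feasible.id.fst Feasible.id.snd
    fun _ p => Polynomial.coeff_sub p.1 p.2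
  mul := Feasible.mul_polynomial

namespace LoopProgram

variable {A : Type}

theorem exists_run_read (A : Type) : ∃ c : LoopProgram Reg (Bool ⊕ A), ∀ N (l : List A),
    l.length ≤ N → c.run N (store [] [] [] (l.map .inr).reverse) = store (word N l) [] [] [] := by
  obtain ⟨c, hc⟩ := Feasible.cons (A := A) (α := A)
  set body : LoopProgram Reg (Bool ⊕ A) :=
    .pop .io fun o => o.elim .skip fun b => .seq (.push .main b) c with hbody
  have hnil : ∀ N m, body.run N (store m [] [] []) = store m [] [] [] := fun _ _ =>
    update_store_io ..
  have hcons : ∀ N a (l : List A) i, body.run N (store (word N l) [] [] (.inr a :: i)) =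
      store (word N (a :: l)) [] [] i := fun N a l i => by
    have h := hc N (a, l) [] i
    rw [List.append_nil, List.append_nil, word_prod] at h
    rw [hbody, run]
    change (LoopProgram.seq (.push .main (.inr a)) c).run N
      (update (store _ [] [] (.inr a :: i)) .io i) = _
    rw [update_store_io, run_seq, run_push_main]
    exact h
  have hiterate : ∀ N (l t : List A) n, l.length ≤ n → (body.run N)^[n]
      (store (word N t) [] [] (l.map .inr)) = store (word N (l.reverse ++ t)) [] [] [] := by
    intro N l
    induction l with
    | nil => exact fun t n _ => iterate_fixed (hnil N (word N t)) n
    | cons a l ih =>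
      rintro t (_ | n) hn
      · contradiction
      rw [iterate_succ_apply, List.map_cons, hcons, ih _ _ (Nat.le_of_succ_le_succ hn),
        List.reverse_cons, List.append_assoc, List.singleton_append]
  refine ⟨.seq (times (List A) (.push .main (.inl false))) (.loop body), fun N l hl => ?_⟩
  rw [run_seq, run_pad, ← word_nil, List.append_nil, ← List.map_reverse, run,
    hiterate N _ _ _ (by rwa [List.length_reverse]), List.reverse_reverse, List.append_nil]

theorem exists_run_write (A : Type) : ∃ c : LoopProgram Reg (Bool ⊕ A), ∀ N (l : List A),
    c.run N (store (word N l) [] [] []) = store [] [] [] ((l.take N).map .inr).reverse := by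
  set body : LoopProgram Reg (Bool ⊕ A) := branch (shift .main .io) (.pop .main fun _ => .skip)
  have hshift : ∀ N a (m i : List (Bool ⊕ A)), (shift .main .io).run N (store (a :: m) [] [] i) =
      store m [] [] (a :: i) := fun N a m i => by
    rw [run_shift (by decide) N rfl, update_store_main, update_store_io]
    rfl
  have hiterate : ∀ N n (l : List A) i, (body.run N)^[n]
      (store (((l.map some).takeD n none).flatMap (word N)) [] [] i) =
      store [] [] [] (((l.take n).map .inr).reverse ++ i) := by
    intro N n
    induction n with
    | zero => intros; rfl
    | succ n ih =>
      intro l i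
      rw [iterate_succ_apply, takeD_map_some_succ, List.flatMap_cons]
      cases l with
      | nil =>
        rw [List.head?_nil, word_none, List.cons_append, run_branch, cond_false]
        refine (congrArg _ (update_store_main ..)).trans ((ih [] i).trans ?_)
        rw [List.take_nil, List.take_nil]
      | cons a l =>
        rw [List.head?_cons, word_some, List.cons_append, run_branch, cond_true]
        refine (congrArg _ (hshift ..)).trans ((ih ..).trans ?_)
        rw [List.take_succ_cons, List.map_cons, List.reverse_cons, List.append_assoc,
          List.singleton_append, List.tail_cons]
  refine ⟨.loop body, fun N l => ?_⟩
  rw [word_list, run, hiterate, List.append_nil]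

end LoopProgram

theorem Feasible.nonempty_tm2ComputableInPolyTime {A Δ α β : Type} [Finite A] [Inhabited Δ]
    {ea : α → List A} {eb : β → List Δ} {F : α → β} {f : ℕ → List A → List A} {wr : A → Δ} {d : ℕ}
    (hf : Feasible A f) (hd : d ≠ 0)
    (h : ∀ a, ((f ((ea a).length ^ d) (ea a)).take ((ea a).length ^ d)).map wr = eb (F a)) :
    Nonempty (Turing.TM2ComputableInPolyTime ea eb F) := by
  obtain ⟨c, hc⟩ := hf
  obtain ⟨r, hr⟩ := exists_run_read A
  obtain ⟨w, hw⟩ := exists_run_write A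
  have : Inhabited (Bool ⊕ A) := ⟨.inl false⟩
  refine LoopProgram.nonempty_tm2ComputableInPolyTime (c := (r.seq (c.seq w)).blowup d)
    (k := .io) (rd := .inr) (wr := Sum.elim default wr) fun a => ?_
  have hinit : update (fun _ => []) .io ((ea a).map .inr).reverse =
      store [] [] [] ((ea a).map (Sum.inr (α := Bool))).reverse := by
    funext k; cases k <;> rfl
  have hrun := hc ((ea a).length ^ d) (ea a) [] []
  rw [List.append_nil, List.append_nil] at hrun
  rw [run_blowup, hinit, run_seq, run_seq, hr _ _ (Nat.le_self_pow hd _), hrun, hw, ← h a]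
  change (((List.take _ _).map Sum.inr).reverse).reverse.map _ = _
  rw [List.reverse_reverse, List.map_map]
  rfl

/-! ### Expectations with respect to a product distribution -/

section ProductWeight

variable {X R : Type*} [Fintype X] [CommRing R]

/-- The weight of an entity if the features are independent, where `w y` is the weight of the
value `1` of the feature `y`. The weights are formal probabilities: they lie in any ring. -/
def entityWeight (w : X → R) (e : X → Bool) : R := ∏ y, if e y then w y else 1 - w y

/-- The expectation of a function on the entities for the product distribution `entityWeight w`. -/
def weightedCount [DecidableEq X] (w : X → R) (f : (X → Bool) → R) : R :=
  ∑ e, f e * entityWeight w e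

variable [DecidableEq X]

theorem weightedCount_one (w : X → R) : weightedCount w (fun _ => 1) = 1 := by
  have := Finset.prod_univ_sum (fun _ : X => (Finset.univ : Finset Bool))
    (fun y b => if b then w y else 1 - w y)
  simp only [Fintype.sum_bool, Bool.false_eq_true, if_true, if_false, add_sub_cancel,
    Finset.prod_const_one, Fintype.piFinset_univ] at this
  simp [weightedCount, entityWeight, ← this]

theorem weightedCount_sub (w : X → R) (f g : (X → Bool) → R) :
    weightedCount w (fun e => f e - g e) = weightedCount w f - weightedCount w g := by
  simp [weightedCount, sub_mul]

theorem weightedCount_sum {ι : Type*} (w : X → R) (s : Finset ι) (f : ι → (X → Bool) → R) :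
    weightedCount w (fun e => ∑ i ∈ s, f i e) = ∑ i ∈ s, weightedCount w (f i) := by
  simp only [weightedCount, Finset.sum_mul]
  exact Finset.sum_comm

theorem weightedCount_mul (w : X → R) {f g : (X → Bool) → R} {S T : Set X} (hf : DependsOn f S)
    (hg : DependsOn g T) (h : Disjoint S T) :
    weightedCount w (fun e => f e * g e) = weightedCount w f * weightedCount w g := by
  classical
  let swap : (X → Bool) × (X → Bool) → (X → Bool) × (X → Bool) := fun p =>
    (S.piecewise p.1 p.2, S.piecewise p.2 p.1)
  have hswap : Function.Involutive swap := fun p => by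
    ext y <;> by_cases hy : y ∈ S <;> simp [swap, hy]
  have hweight : ∀ p, entityWeight w (swap p).1 * entityWeight w (swap p).2 =
      entityWeight w p.1 * entityWeight w p.2 := fun p => by
    simp only [entityWeight, ← Finset.prod_mul_distrib]
    refine Finset.prod_congr rfl fun y _ => ?_
    by_cases hy : y ∈ S <;> simp [swap, hy, mul_comm]
  have hprod : ∀ f g, weightedCount w f * weightedCount w g =
      ∑ p : (X → Bool) × (X → Bool), f p.1 * g p.2 * (entityWeight w p.1 * entityWeight w p.2) :=
    fun f g => by
      rw [weightedCount, weightedCount, Finset.sum_mul_sum, Fintype.sum_prod_type]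
      exact Finset.sum_congr rfl fun _ _ => Finset.sum_congr rfl fun _ _ => mul_mul_mul_comm ..
  rw [← mul_one (weightedCount w _), ← weightedCount_one w, hprod, hprod,
    ← Equiv.sum_comp hswap.toPerm]
  refine Finset.sum_congr rfl fun p _ => ?_
  have hfst : f (S.piecewise p.1 p.2) = f p.1 := hf fun y hy => Set.piecewise_eq_of_mem _ _ _ hy
  have hsnd : g (S.piecewise p.1 p.2) = g p.2 := hg fun y hy =>
    Set.piecewise_eq_of_notMem _ _ _ (Set.disjoint_right.1 h hy)
  rw [Function.Involutive.coe_toPerm, hweight, mul_one, hfst, hsnd]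

theorem weightedCount_prod {ι : Type*} (w : X → R) (s : Finset ι) (f : ι → (X → Bool) → R)
    (S : ι → Set X) (hf : ∀ i ∈ s, DependsOn (f i) (S i))
    (hS : ∀ i ∈ s, ∀ j ∈ s, i ≠ j → Disjoint (S i) (S j)) :
    weightedCount w (fun e => ∏ i ∈ s, f i e) = ∏ i ∈ s, weightedCount w (f i) := by
  classical
  induction s using Finset.induction_on with
  | empty => simpa only [Finset.prod_empty] using weightedCount_one w
  | insert a s ha ih =>
    rw [Finset.forall_mem_insert] at hf
    have hs : ∀ i ∈ s, ∀ j ∈ s, i ≠ j → Disjoint (S i) (S j) := fun i hi j hj =>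
      hS i (Finset.mem_insert_of_mem hi) j (Finset.mem_insert_of_mem hj)
    simp only [Finset.prod_insert ha]
    rw [← ih hf.2 hs]
    refine weightedCount_mul w hf.1 (T := ⋃ i ∈ s, S i) ?_ ?_
    · exact fun e e' h => Finset.prod_congr rfl fun i hi =>
        hf.2 i hi fun y hy => h y (Set.mem_biUnion hi hy)
    · refine Set.disjoint_iUnion₂_right.2 fun i hi => ?_
      exact hS a (Finset.mem_insert_self a s) i (Finset.mem_insert_of_mem hi)
        (ne_of_mem_of_not_mem hi ha).symm

theorem weightedCount_apply (w : X → R) (y : X) :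
    weightedCount w (fun e => if e y then 1 else 0) = w y := by
  have := Finset.prod_univ_sum (fun _ : X => (Finset.univ : Finset Bool))
    (fun y' b => if b then w y' else if y' = y then 0 else 1 - w y')
  simp only [Fintype.sum_bool, Bool.false_eq_true, if_true, if_false, Fintype.piFinset_univ] at this
  have hprod : ∏ y', (w y' + if y' = y then 0 else 1 - w y') = w y := by
    rw [Finset.prod_eq_single y (fun y' _ h => by rw [if_neg h, add_sub_cancel]) (by simp),
      if_pos rfl, add_zero]
  rw [hprod] at this
  rw [this, weightedCount]
  refine Finset.sum_congr rfl fun e _ => ?_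
  cases h : e y
  · rw [Finset.prod_eq_zero (Finset.mem_univ y) (by simp [h]), if_neg Bool.false_ne_true, zero_mul]
  · rw [if_pos rfl, one_mul, entityWeight]
    refine Finset.prod_congr rfl fun y' _ => ?_
    obtain rfl | h' := eq_or_ne y' y
    · rw [h, if_pos rfl, if_pos rfl]
    · rw [if_neg h']

end ProductWeight

namespace BoolCircuit

variable {X : Type} (C : BoolCircuit X)

theorem dependsOn_eval (g : Fin C.size) : DependsOn (fun e => C.eval e g) (C.vars g) := by
  induction g using C.wire_wellFounded.induction with
  | _ g ih =>
    intro e e' h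
    have hin : ∀ i ∈ C.inputs g, C.eval e i = C.eval e' i := fun i hi =>
      ih i hi fun y ⟨h', hr, hl⟩ => h y ⟨h', hr.tail hi, hl⟩
    change C.eval e g = C.eval e' g
    rw [eval_eq, eval_eq]
    cases hl : C.label g with
    | var x => exact h x ⟨g, .refl, hl⟩
    | const b => rfl
    | and => exact decide_eq_decide.2 (forall₂_congr fun i hi => by rw [hin i hi])
    | or =>
      exact decide_eq_decide.2 (exists_congr fun i => and_congr_right fun hi => by rw [hin i hi])
    | not =>
      exact decide_eq_decide.2 (exists_congr fun i => and_congr_right fun hi => by rw [hin i hi])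

variable [Fintype X] [DecidableEq X] {R : Type*} [CommRing R]

/-- The weighted model count of a gate: the probability that its value is `1`. -/
noncomputable def modelCount (w : X → R) (g : Fin C.size) : R :=
  weightedCount w fun e => if C.eval e g then 1 else 0

variable {C} {w : X → R} {g : Fin C.size}

theorem modelCount_var {x : X} (h : C.label g = .var x) : C.modelCount w g = w x := by
  rw [modelCount, ← weightedCount_apply w x]
  congr 1
  funext e
  rw [eval_eq, h]

theorem modelCount_const {b : Bool} (h : C.label g = .const b) :
    C.modelCount w g = if b then 1 else 0 := by
  have : ∀ e, C.eval e g = b := fun e => by rw [eval_eq, h]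
  simp only [modelCount, this]
  cases b
  · exact Finset.sum_eq_zero fun _ _ => zero_mul _
  · exact weightedCount_one w

theorem modelCount_and (hC : C.Decomposable) (h : C.label g = .and) :
    C.modelCount w g = ∏ i ∈ C.inputs g, C.modelCount w i := by
  simp only [modelCount]
  rw [← weightedCount_prod w (C.inputs g) (fun i e => if C.eval e i then 1 else 0) C.vars]
  · congr 1
    funext e
    rw [eval_eq, h, Finset.prod_boole]
    simp
  · intro i _ e e' he
    have : C.eval e i = C.eval e' i := C.dependsOn_eval i he
    simp only [this]
  · exact hC g h

theorem modelCount_or (hC : C.Deterministic) (h : C.label g = .or) :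
    C.modelCount w g = ∑ i ∈ C.inputs g, C.modelCount w i := by
  simp only [modelCount]
  rw [← weightedCount_sum]
  congr 1
  funext e
  rw [eval_eq, h]
  by_cases h' : ∃ i ∈ C.inputs g, C.eval e i = true
  · obtain ⟨i, hi, hi'⟩ := h'
    rw [if_pos (decide_eq_true ⟨i, hi, hi'⟩), Finset.sum_eq_single i, if_pos hi']
    · intro j hj hij
      exact if_neg fun hj' => hC g h j hj i hi hij ⟨e, hj', hi'⟩
    · exact fun h => absurd hi h
  · rw [if_neg (by simpa using h')]
    exact (Finset.sum_eq_zero fun i hi => if_neg fun hi' => h' ⟨i, hi, hi'⟩).symm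

theorem modelCount_not (h : C.label g = .not) :
    C.modelCount w g = 1 - ∑ i ∈ C.inputs g, C.modelCount w i := by
  obtain ⟨i, hi⟩ := Finset.card_eq_one.1 (C.not_fanin g h)
  have := weightedCount_sub w (fun _ => 1) fun e => if C.eval e i then 1 else 0
  rw [weightedCount_one] at this
  rw [hi, Finset.sum_singleton, modelCount, modelCount, ← this]
  congr 1
  funext e
  rw [eval_eq, h, hi]
  by_cases h : C.eval e i = true <;> simp [h]

end BoolCircuit

/-! ### The SHAP-score as an integral -/

section Integral

open Polynomial

/-- The integral of a polynomial over the interval from zero to one half. -/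
noncomputable def halfIntegral : ℤ[X] →ₗ[ℤ] ℚ :=
  lsum fun k => LinearMap.toSpanSingleton ℤ ℚ (1 / ((k + 1) * 2 ^ (k + 1)))

theorem halfIntegral_eq_sum {p : ℤ[X]} {n : ℕ} (h : p.natDegree < n) :
    halfIntegral p = ∑ k ∈ Finset.range n, (p.coeff k : ℚ) / ((k + 1) * 2 ^ (k + 1)) := by
  rw [halfIntegral, lsum_apply, sum_over_range' p _ n h]
  · refine Finset.sum_congr rfl fun k _ => ?_
    simp [div_eq_mul_inv]
  · simp

theorem halfIntegral_X_pow (k : ℕ) : halfIntegral (X ^ k) = 1 / ((k + 1) * 2 ^ (k + 1)) := by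
  rw [← monomial_one_right_eq_X_pow, halfIntegral, lsum_apply, sum_monomial_index _ _ (by simp)]
  simp

theorem halfIntegral_one_sub_two_X_pow_mul_X_pow (s j : ℕ) :
    halfIntegral ((1 - 2 * X) ^ s * X ^ j) =
      (s.factorial * j.factorial : ℚ) / ((s + j + 1).factorial * 2 ^ (j + 1)) := by
  induction s generalizing j with
  | zero =>
    rw [pow_zero, one_mul, halfIntegral_X_pow, zero_add, Nat.factorial_succ, Nat.factorial_zero]
    push_cast
    field_simp
  | succ s ih =>
    have hsplit : ((1 : ℤ[X]) - 2 * X) ^ (s + 1) * X ^ j =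
        (1 - 2 * X) ^ s * X ^ j - (2 : ℤ) • ((1 - 2 * X) ^ s * X ^ (j + 1)) := by
      rw [zsmul_eq_mul]
      push_cast
      ring
    rw [hsplit, map_sub, map_zsmul, ih, ih, show s + 1 + j + 1 = s + j + 1 + 1 by ring,
      show s + (j + 1) + 1 = s + j + 1 + 1 by ring, Nat.factorial_succ (s + j + 1),
      Nat.factorial_succ s, Nat.factorial_succ j, zsmul_eq_mul]
    push_cast
    field_simp
    ring

end Integral

section Shap

variable {X R : Type} [DecidableEq X] [CommRing R]

/-- The weights for which each feature `y ≠ x` agrees with the entity `e` with weight `1 - V`, and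
the feature `x` surely agrees with it if `c` is true, and surely disagrees otherwise. -/
def agreementWeight (V : R) (e : X → Bool) (x : X) (c : Bool) (y : X) : R :=
  if y = x then (if e y = c then 1 else 0) else if e y then 1 - V else V

theorem natDegree_agreementWeight_le (e : X → Bool) (x : X) (c : Bool) (y : X) :
    (agreementWeight (Polynomial.X : Polynomial R) e x c y).natDegree ≤ 1 := by
  have hX := Polynomial.natDegree_X_le (R := R)
  rw [agreementWeight]
  split_ifs
  · exact Polynomial.natDegree_one.trans_le zero_le_one
  · exact Polynomial.natDegree_zero.trans_le zero_le_one
  · exact Polynomial.natDegree_sub_le_of_le (Polynomial.natDegree_one.trans_le zero_le_one) hX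
  · exact hX

variable [Fintype X]

/-- The number of positive entities that agree with `e` on `S`, and agree with `e` on `x` if `c` is
true and disagree otherwise. -/
def agreementCount (M : (X → Bool) → Bool) (e : X → Bool) (x : X) (c : Bool) (S : Finset X) : ℕ :=
  (Finset.univ.filter fun e' => (decide (e' x = e x) = c ∧ ∀ y ∈ S, e' y = e y) ∧ M e' = true).card

/-- An agreement has weight `1 - V = (1 - 2 * V) + V`; the sets `S` come from expanding the product
of these sums. -/
theorem entityWeight_agreementWeight (V : R) (e : X → Bool) (x : X) (c : Bool) (e' : X → Bool) :
    entityWeight (agreementWeight V e x c) e' =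
      ∑ S ∈ (Finset.univ.erase x).powerset,
        if decide (e' x = e x) = c ∧ ∀ y ∈ S, e' y = e y then
          (1 - 2 * V) ^ S.card * V ^ (Fintype.card X - 1 - S.card) else 0 := by
  have hne : ∏ y ∈ Finset.univ.erase x,
      (if e' y then agreementWeight V e x c y else 1 - agreementWeight V e x c y) =
        ∏ y ∈ Finset.univ.erase x, ((if e' y = e y then 1 - 2 * V else 0) + V) := by
    refine Finset.prod_congr rfl fun y hy => ?_
    rw [agreementWeight, if_neg (Finset.ne_of_mem_erase hy)]
    cases e y <;> cases e' y <;> simp <;> ring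
  have heq : (if e' x then agreementWeight V e x c x else 1 - agreementWeight V e x c x) =
      if decide (e' x = e x) = c then 1 else 0 := by
    rw [agreementWeight, if_pos rfl]
    cases e x <;> cases e' x <;> cases c <;> simp
  rw [entityWeight, ← Finset.mul_prod_erase _ _ (Finset.mem_univ x), hne, heq, Finset.prod_add,
    Finset.mul_sum]
  refine Finset.sum_congr rfl fun S hS => ?_
  rw [Finset.prod_ite_zero, Finset.prod_const, Finset.prod_const,
    Finset.card_sdiff_of_subset (Finset.mem_powerset.1 hS),
    Finset.card_erase_of_mem (Finset.mem_univ x), Finset.card_univ, ite_zero_mul, one_mul,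
    ite_zero_mul, ← ite_and]
  congr

theorem weightedCount_agreementWeight (M : (X → Bool) → Bool) (V : R) (e : X → Bool) (x : X)
    (c : Bool) :
    weightedCount (agreementWeight V e x c) (fun e' => if M e' then 1 else 0) =
      ∑ S ∈ (Finset.univ.erase x).powerset, (agreementCount M e x c S : R) *
        ((1 - 2 * V) ^ S.card * V ^ (Fintype.card X - 1 - S.card)) := by
  simp only [weightedCount, entityWeight_agreementWeight, Finset.mul_sum]
  rw [Finset.sum_comm]
  refine Finset.sum_congr rfl fun S _ => ?_
  rw [agreementCount, ← nsmul_eq_mul, ← Finset.sum_const, Finset.sum_filter]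
  refine Finset.sum_congr rfl fun e' _ => ?_
  rw [ite_zero_mul_ite_zero, one_mul]
  exact if_congr and_comm rfl rfl

theorem card_consistentWith (e : X → Bool) (S : Finset X) :
    (consistentWith e S).card = 2 ^ (Fintype.card X - S.card) := by
  have hpi : consistentWith e S =
      Fintype.piFinset fun y => if y ∈ S then {e y} else Finset.univ := by
    ext e'
    simp only [consistentWith, Finset.mem_filter, Finset.mem_univ, true_and, Fintype.mem_piFinset]
    refine forall_congr' fun y => ?_
    by_cases h : y ∈ S <;> simp [h]
  rw [hpi, Fintype.card_piFinset, ← Finset.card_compl, ← Finset.prod_const,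
    ← Finset.prod_subset (Finset.subset_univ Sᶜ)]
  · refine Finset.prod_congr rfl fun y hy => ?_
    rw [if_neg (Finset.mem_compl.1 hy), Finset.card_univ, Fintype.card_bool]
  · intro y _ hy
    rw [if_pos (Finset.notMem_compl.1 hy), Finset.card_singleton]

theorem expectedValue_eq (M : (X → Bool) → Bool) (e : X → Bool) (S : Finset X) :
    expectedValue M e S = (((consistentWith e S).filter fun e' => M e' = true).card : ℚ) /
      2 ^ (Fintype.card X - S.card) := by
  simp only [expectedValue, uniformProb, card_consistentWith, Finset.card_singleton]
  rw [← Finset.mul_sum, Finset.sum_boole]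
  push_cast
  field_simp

theorem expectedValue_nonneg (M : (X → Bool) → Bool) (e : X → Bool) (S : Finset X) :
    0 ≤ expectedValue M e S := by
  rw [expectedValue_eq]
  positivity

theorem expectedValue_le_one (M : (X → Bool) → Bool) (e : X → Bool) (S : Finset X) :
    expectedValue M e S ≤ 1 := by
  rw [expectedValue_eq]
  refine div_le_one_of_le₀ ?_ (by positivity)
  exact_mod_cast (Finset.card_filter_le ..).trans_eq (card_consistentWith e S)

theorem expectedValue_sub (M : (X → Bool) → Bool) (e : X → Bool) {x : X} {S : Finset X}
    (hx : x ∉ S) :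
    expectedValue M e (insert x S) - expectedValue M e S =
      ((agreementCount M e x true S : ℚ) - agreementCount M e x false S) /
        2 ^ (Fintype.card X - S.card) := by
  have hS : S.card + 1 ≤ Fintype.card X := by
    rw [← Finset.card_insert_of_notMem hx]
    exact Finset.card_le_univ _
  have hinsert : ((consistentWith e (insert x S)).filter fun e' => M e' = true).card =
      agreementCount M e x true S := by
    simp only [agreementCount, consistentWith, Finset.filter_filter, Finset.forall_mem_insert,
      decide_eq_true_eq]
  have hsplit : ((consistentWith e S).filter fun e' => M e' = true).card =
      agreementCount M e x true S + agreementCount M e x false S := by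
    rw [← Finset.card_filter_add_card_filter_not fun e' => e' x = e x]
    simp only [agreementCount, consistentWith, Finset.filter_filter, decide_eq_true_eq,
      decide_eq_false_iff_not, and_comm, and_left_comm]
  rw [expectedValue_eq, expectedValue_eq, hinsert, hsplit, Finset.card_insert_of_notMem hx,
    show Fintype.card X - S.card = Fintype.card X - (S.card + 1) + 1 by omega, pow_succ]
  push_cast
  field_simp
  ring

theorem SHAP_eq_halfIntegral (M : (X → Bool) → Bool) (e : X → Bool) (x : X) :
    SHAP M e x = halfIntegral
      (weightedCount (agreementWeight Polynomial.X e x true) (fun e' => if M e' then 1 else 0) -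
        weightedCount (agreementWeight Polynomial.X e x false)
          (fun e' => if M e' then 1 else 0)) := by
  rw [weightedCount_agreementWeight, weightedCount_agreementWeight, ← Finset.sum_sub_distrib,
    map_sum, SHAP]
  refine Finset.sum_congr rfl fun S hS => ?_
  have hx : x ∉ S := fun h => Finset.notMem_erase x _ (Finset.mem_powerset.1 hS h)
  have hS : S.card + 1 ≤ Fintype.card X := by
    rw [← Finset.card_insert_of_notMem hx]
    exact Finset.card_le_univ _
  have hzsmul : ∀ (m n : ℕ) (p : Polynomial ℤ),
      (m : Polynomial ℤ) * p - n * p = ((m : ℤ) - n) • p := fun m n p => by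
    rw [zsmul_eq_mul, ← sub_mul]
    push_cast
    rfl
  rw [hzsmul, map_zsmul, halfIntegral_one_sub_two_X_pow_mul_X_pow, expectedValue_sub M e hx,
    show S.card + (Fintype.card X - 1 - S.card) + 1 = Fintype.card X by omega,
    show Fintype.card X - 1 - S.card + 1 = Fintype.card X - S.card by omega,
    show Fintype.card X - S.card - 1 = Fintype.card X - 1 - S.card by omega, zsmul_eq_mul]
  push_cast
  field_simp

/-- The coefficients in the definition of the SHAP-score are the probabilities that `S` is the set
of the features before `x` in a random order. -/
theorem sum_SHAP_weights (x : X) : ∑ S ∈ (Finset.univ.erase x).powerset,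
    ((S.card.factorial : ℚ) * ((Fintype.card X - S.card - 1).factorial : ℚ) /
      ((Fintype.card X).factorial : ℚ)) = 1 := by
  obtain ⟨n, hn⟩ : ∃ n, Fintype.card X = n + 1 :=
    Nat.exists_eq_add_one_of_ne_zero (Fintype.card_pos_iff.2 ⟨x⟩).ne'
  rw [Finset.sum_powerset_apply_card fun k => (k.factorial : ℚ) *
      ((Fintype.card X - k - 1).factorial : ℚ) / ((Fintype.card X).factorial : ℚ),
    Finset.card_erase_of_mem (Finset.mem_univ x), Finset.card_univ, hn, Nat.add_sub_cancel]
  have hterm : ∀ k ∈ Finset.range (n + 1), n.choose k •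
      ((k.factorial : ℚ) * ((n + 1 - k - 1).factorial : ℚ) / ((n + 1).factorial : ℚ)) =
      1 / (n + 1) := fun k hk => by
    have hchoose := Nat.choose_mul_factorial_mul_factorial
      (Nat.le_of_lt_succ (Finset.mem_range.1 hk))
    rw [show n + 1 - k - 1 = n - k by omega, Nat.factorial_succ, ← hchoose, nsmul_eq_mul]
    push_cast
    have : (n.choose k : ℚ) ≠ 0 := by
      exact_mod_cast (Nat.choose_pos (Nat.le_of_lt_succ (Finset.mem_range.1 hk))).ne'
    field_simp
  rw [Finset.sum_congr rfl hterm, Finset.sum_const, Finset.card_range, nsmul_eq_mul]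
  push_cast
  field_simp

theorem abs_SHAP_le_one (M : (X → Bool) → Bool) (e : X → Bool) (x : X) : |SHAP M e x| ≤ 1 := by
  rw [← sum_SHAP_weights x]
  refine (Finset.abs_sum_le_sum_abs _ _).trans (Finset.sum_le_sum fun S _ => ?_)
  rw [abs_mul, abs_of_nonneg (by positivity)]
  refine mul_le_of_le_one_right (by positivity) (abs_sub_le_iff.2 ⟨?_, ?_⟩)
  · linarith [expectedValue_le_one M e (insert x S), expectedValue_nonneg M e S]
  · linarith [expectedValue_le_one M e S, expectedValue_nonneg M e (insert x S)]

theorem natDegree_weightedCount_le {w : X → Polynomial R} (hw : ∀ y, (w y).natDegree ≤ 1)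
    (M : (X → Bool) → Bool) :
    (weightedCount w fun e => if M e then 1 else 0).natDegree ≤ Fintype.card X := by
  refine Polynomial.natDegree_sum_le_of_forall_le _ _ fun e _ => ?_
  have hfactor : ∀ y, (if e y then w y else 1 - w y).natDegree ≤ 1 := fun y => by
    split_ifs
    · exact hw y
    · exact Polynomial.natDegree_sub_le_of_le (Polynomial.natDegree_one.trans_le zero_le_one) (hw y)
  have hprod : (entityWeight w e).natDegree ≤ Fintype.card X :=
    (Polynomial.natDegree_prod_le _ _).trans
      ((Finset.sum_le_card_nsmul _ _ 1 fun y _ => hfactor y).trans_eq (mul_one _))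
  rw [ite_zero_mul, one_mul]
  split_ifs
  · exact hprod
  · exact Polynomial.natDegree_zero.trans_le (Nat.zero_le _)

end Shap

/-! ### The algorithm -/

/-- One step of `splitRows`: a bit extends the current row, and any other symbol completes it. -/
def splitRow (s : InputSymbol) (t : List Bool × List (InputSymbol × List Bool)) :
    List Bool × List (InputSymbol × List Bool) :=
  match s with
  | .bit b => (b :: t.1, t.2)
  | s => ([], (s, t.1) :: t.2)

/-- The bits before the first other symbol, and then each other symbol with the bits after it. -/
def splitRows (l : List InputSymbol) : List Bool × List (InputSymbol × List Bool) :=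
  l.foldr splitRow ([], [])

section Ring

variable {R : Type} [CommRing R]

/-- The weight of the value `1` of a feature from the bits by which the feature is encoded: this is
`agreementWeight` if `v` is the value of the entity and `m` tells whether the feature is marked. -/
def featureWeight (V : R) (c v m : Bool) : R :=
  bif m then (bif v ^^ c then 0 else 1) else bif v then 1 - V else V

/-- One step of `featureWeights`, where the first component is a mark that waits for its value. -/
def readFeature (V : R) (c b : Bool) (t : Option Bool × List R) : Option Bool × List R :=
  t.1.elim (some b, t.2) fun m => (none, featureWeight V c b m :: t.2)

/-- The weights of the features that are encoded by a list of alternating values and marks. -/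
def featureWeights (V : R) (c : Bool) (l : List Bool) : List R :=
  (l.foldr (readFeature V c) (none, [])).2

/-- The sum of the values that are selected by a row of bits. -/
def rowSum (row : List Bool) (values : List R) : R :=
  ((row.zip values).map fun p => bif p.1 then p.2 else 0).sum

/-- The product of the values that are selected by a row of bits. -/
def rowProd (row : List Bool) (values : List R) : R :=
  ((row.zip values).map fun p => bif p.1 then p.2 else 1).prod

/-- The value of a gate, given its kind and its row, from the values that its row refers to. -/
def gateValue (s : InputSymbol) (row : List Bool) (values : List R) : R :=
  match s with
  | .andGate | .constGate true => rowProd row values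
  | .notGate => 1 - rowSum row values
  | _ => rowSum row values

/-- One round of updates of the values of all gates. The first bit of the row of a gate tells
whether it is the output gate. -/
def updateValues (weights : List R) (gates : List (InputSymbol × List Bool)) (values : List R) :
    List R :=
  gates.map fun g => gateValue g.1 g.2.tail (weights ++ values)

/-- The value of the output gate after `N` rounds of updates. -/
def outputValue (N : ℕ) (V : R) (c : Bool) (l : List InputSymbol) : R :=
  let gates := (splitRows l).2.tail
  rowSum (gates.map fun g => g.2.head?.getD false)
    ((updateValues (featureWeights V c (splitRows l).1) gates)^[N] (gates.map fun _ => 0))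

end Ring

/-- One step of the summation of `a k / ((k + 1) * 2 ^ (k + 1))`. The components of the state are
`k`, `k !`, the denominator `k ! * 2 ^ k`, and the numerator. -/
def addTerm (s : ℤ × ℤ × ℤ × ℤ) (a : ℤ) : ℤ × ℤ × ℤ × ℤ :=
  (s.1 + 1, s.2.1 * (s.1 + 1), s.2.2.1 * ((s.1 + 1) + (s.1 + 1)),
    s.2.2.2 * ((s.1 + 1) + (s.1 + 1)) + a * s.2.1)

/-- One step of `trimDigits`, where the first component tells whether there was a nonzero digit. -/
def pushDigit (s : Bool × List Bool) (b : Bool) : Bool × List Bool :=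
  (s.1 || b, bif s.1 || b then b :: s.2 else s.2)

/-- The digits in the opposite order, without the leading zeros of the given list. -/
def trimDigits (l : List Bool) : List Bool :=
  (l.foldl pushDigit (false, [])).2

/-- The encoding of a fraction, provided that its components are small enough to be determined by
their last `N` digits. The symbol `endEntity` stands for the separator. -/
def writeFraction (N : ℕ) (r : ℤ × ℤ) : List InputSymbol :=
  let sign := (bits N r.1).head?.getD false
  .bit sign :: ((trimDigits (bits N (bif sign then 0 - r.1 else r.1))).map .bit ++
    .endEntity :: (trimDigits (bits N r.2)).map .bit)

/-- The algorithm. The sum is cut off after as many terms as there are symbols in the input. -/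
noncomputable def shapFraction (N : ℕ) (l : List InputSymbol) : List InputSymbol :=
  let p : Polynomial ℤ := outputValue N .X true l - outputValue N .X false l
  writeFraction N
    ((((coeffs N p).zip l).map Prod.fst).foldl addTerm (0, 1, 1, 0)).2.2.swap

/-! ### Feasibility of the algorithm -/

theorem length_splitRows_fst_le (l : List InputSymbol) : (splitRows l).1.length ≤ l.length := by
  induction l with
  | nil => exact le_rfl
  | cons s l ih =>
    cases s with
    | bit b => exact Nat.succ_le_succ ih
    | _ => exact Nat.zero_le _

theorem length_le_of_mem_splitRows_snd {l : List InputSymbol} {g : InputSymbol × List Bool}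
    (hg : g ∈ (splitRows l).2) : g.2.length ≤ l.length := by
  induction l with
  | nil => cases hg
  | cons s l ih =>
    cases s with
    | bit b => exact (ih hg).trans (Nat.le_succ _)
    | _ =>
      obtain rfl | hg := List.mem_cons.1 hg
      · exact (length_splitRows_fst_le l).trans (Nat.le_succ _)
      · exact (ih hg).trans (Nat.le_succ _)

theorem length_splitRows_snd_le (l : List InputSymbol) : (splitRows l).2.length ≤ l.length := by
  induction l with
  | nil => exact le_rfl
  | cons s l ih =>
    cases s with
    | bit b => exact ih.trans (Nat.le_succ _)
    | _ => exact Nat.succ_le_succ ih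

namespace Feasible

variable {A α β γ R : Type} [Layout A α] [Layout A β] [Layout A γ]

theorem iterate_with {f : ℕ → α → β → β} {s : ℕ → α → β}
    (hf : Feasible A fun N (p : α × β) => f N p.1 p.2) (hs : Feasible A s) :
    Feasible A fun N a => (f N a)^[N] (s N a) := by
  refine of_eq ((iterate (id.fst.pair hf)).comp (id.pair hs)).snd fun N a => ?_
  have hpair : Semiconj (fun b => (a, b)) (f N a) fun p : α × β => (p.1, f N p.1 p.2) :=
    fun _ => rfl
  exact congrArg Prod.snd (hpair.iterate_right N (s N a)).symm

theorem head?_getD (d : β) {l : ℕ → α → List β} (hl : Feasible A l)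
    (hd : Feasible A fun _ (_ : α) => d) :
    Feasible A fun N a => ((l N a).take N).head?.getD d :=
  of_eq ((option_elim hd id.fst).comp ((uncons.comp hl).fst.pair id)) fun N a => by
    cases (l N a).take N <;> rfl

theorem tail {l : ℕ → α → List β} (hl : Feasible A l) :
    Feasible A fun N a => ((l N a).take N).tail :=
  (uncons.comp hl).snd

section Ring

variable [CommRing R] [Layout A R] [FeasibleRing A R]

theorem rowSum {row : ℕ → α → List Bool} {values : ℕ → α → List R} (hrow : Feasible A row)
    (hvalues : Feasible A values) :
    Feasible A fun N a => _root_.rowSum ((row N a).take N) (values N a) := by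
  have hterm : Feasible A fun _ (p : α × Bool × R) => bif p.2.1 then p.2.2 else 0 :=
    id.snd.fst.cond id.snd.snd FeasibleRing.zero
  have hsum := ((hrow.take.zip hvalues).map (f := fun _ _ p => bif p.1 then p.2 else 0) hterm).foldr
    (step := fun _ _ x y => x + y) FeasibleRing.zero (id.snd.add id.fst.snd)
  exact hsum.of_eq fun N a => by rw [List.take_of_length_le (by simp)]; rfl

theorem rowProd {row : ℕ → α → List Bool} {values : ℕ → α → List R} (hrow : Feasible A row)
    (hvalues : Feasible A values) :
    Feasible A fun N a => _root_.rowProd ((row N a).take N) (values N a) := by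
  have hterm : Feasible A fun _ (p : α × Bool × R) => bif p.2.1 then p.2.2 else 1 :=
    id.snd.fst.cond id.snd.snd FeasibleRing.one
  have hprod := ((hrow.take.zip hvalues).map (f := fun _ _ p => bif p.1 then p.2 else 1)
    hterm).foldr (step := fun _ _ x y => x * y) FeasibleRing.one (id.snd.mul id.fst.snd)
  exact hprod.of_eq fun N a => by rw [List.take_of_length_le (by simp)]; rfl

theorem featureWeights {V : ℕ → α → R} {l : ℕ → α → List Bool} (hV : Feasible A V) (c : Bool)
    (hl : Feasible A l) :
    Feasible A fun N a => _root_.featureWeights (V N a) c ((l N a).take N) := by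
  have hread : Feasible A fun N (p : (α × Option Bool × List R) × Bool) =>
      readFeature (V N p.1.1) c p.2 p.1.2 := by
    have hnone : Feasible A fun _ (q : (α × Option Bool × List R) × Bool) =>
        (Option.some q.2, q.1.2.2) := (some.comp id.snd).pair id.fst.snd.snd
    have hweight : Feasible A fun N (q : Bool × (α × Option Bool × List R) × Bool) =>
        featureWeight (V N q.2.1.1) c q.2.2 q.1 :=
      id.fst.cond ((id.snd.snd.xor (bool c)).cond FeasibleRing.zero FeasibleRing.one)
        (id.snd.snd.cond (FeasibleRing.one.sub (hV.comp id.snd.fst.fst)) (hV.comp id.snd.fst.fst))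
    have hsome : Feasible A fun N (q : Bool × (α × Option Bool × List R) × Bool) =>
        ((Option.none : Option Bool), featureWeight (V N q.2.1.1) c q.2.2 q.1 :: q.2.1.2.2) :=
      none.pair (hweight.cons' id.snd.fst.snd.snd)
    exact (option_elim hnone hsome).comp (id.fst.snd.fst.pair id)
  exact (hl.foldr (step := fun N a b t => readFeature (V N a) c b t) (none.pair nil) hread).snd

end Ring

end Feasible

namespace Feasible

variable {α R : Type} [Layout InputSymbol α]

theorem splitRows {l : ℕ → α → List InputSymbol} (hl : Feasible InputSymbol l) :
    Feasible InputSymbol fun N a => _root_.splitRows ((l N a).take N) := by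
  have hstep : Feasible InputSymbol fun _
      (q : InputSymbol × List Bool × List (InputSymbol × List Bool)) => splitRow q.1 q.2 := by
    refine letter_elim (f := fun s _ t => splitRow s t) fun s => ?_
    cases s with
    | bit b => exact ((bool b).cons' id.fst).pair id.snd
    | _ => exact nil.pair (((letter _).pair id.fst).cons' id.snd)
  exact hl.foldr (step := fun _ _ => splitRow) (nil.pair nil) (hstep.comp (id.snd.pair id.fst.snd))

section Ring

variable [CommRing R] [Layout InputSymbol R] [FeasibleRing InputSymbol R]

theorem gateValue {s : ℕ → α → InputSymbol} {row : ℕ → α → List Bool} {values : ℕ → α → List R}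
    (hs : Feasible InputSymbol s) (hrow : Feasible InputSymbol row)
    (hvalues : Feasible InputSymbol values) :
    Feasible InputSymbol fun N a => _root_.gateValue (s N a) ((row N a).take N) (values N a) := by
  have hsum := hrow.rowSum hvalues
  have hprod := hrow.rowProd hvalues
  refine (letter_elim (f := fun x N a => _root_.gateValue x ((row N a).take N) (values N a))
    fun x => ?_).comp (hs.pair id)
  rcases x with _ | _ | b | _ | _ | _ | _
  · exact hsum
  · exact hsum
  · cases b
    exacts [hsum, hprod]
  · exact hprod
  · exact hsum
  · exact FeasibleRing.one.sub hsum
  · exact hsum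

theorem updateValues {gates : ℕ → α → List (InputSymbol × List Bool)}
    {weights values : ℕ → α → List R} (hweights : Feasible InputSymbol weights)
    (hgates : Feasible InputSymbol gates) (hlen : ∀ N a, ∀ g ∈ gates N a, g.2.length ≤ N)
    (hvalues : Feasible InputSymbol values) :
    Feasible InputSymbol fun N a => _root_.updateValues (weights N a) (gates N a) (values N a) := by
  have hgate : Feasible InputSymbol fun N (p : α × InputSymbol × List Bool) =>
      _root_.gateValue p.2.1 (((p.2.2.take N).tail).take N) (weights N p.1 ++ values N p.1) :=
    gateValue id.snd.fst id.snd.snd.tail ((hweights.comp id.fst).append (hvalues.comp id.fst))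
  refine of_eq (hgates.map (f := fun N a g =>
    _root_.gateValue g.1 (((g.2.take N).tail).take N) (weights N a ++ values N a)) hgate)
    fun N a => List.map_congr_left fun g hg => ?_
  have hlen' := hlen N a g hg
  rw [List.take_of_length_le hlen', List.take_of_length_le (by rw [List.length_tail]; omega)]

theorem outputValue {V : ℕ → α → R} {l : ℕ → α → List InputSymbol} (hV : Feasible InputSymbol V)
    (c : Bool) (hl : Feasible InputSymbol l) :
    Feasible InputSymbol fun N a => _root_.outputValue N (V N a) c ((l N a).take N) := by
  set gates : ℕ → α → List (InputSymbol × List Bool) := fun N a =>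
    (_root_.splitRows ((l N a).take N)).2.tail with hgates_def
  set bits : ℕ → α → List Bool := fun N a => (_root_.splitRows ((l N a).take N)).1
  have hlength : ∀ N a, (_root_.splitRows ((l N a).take N)).2.length ≤ N := fun N a =>
    (length_splitRows_snd_le _).trans (List.length_take_le ..)
  have hrows : ∀ N a, ∀ g ∈ gates N a, g.2.length ≤ N := fun N a g hg =>
    (length_le_of_mem_splitRows_snd (List.mem_of_mem_tail hg)).trans (List.length_take_le ..)
  have hbits : ∀ N a, (bits N a).take N = bits N a := fun N a =>
    List.take_of_length_le ((length_splitRows_fst_le _).trans (List.length_take_le ..))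
  have hgates : Feasible InputSymbol gates := of_eq hl.splitRows.snd.tail fun N a => by
    rw [List.take_of_length_le (hlength N a)]
  have hweights : Feasible InputSymbol fun N a => _root_.featureWeights (V N a) c (bits N a) :=
    of_eq (hV.featureWeights c hl.splitRows.fst) fun N a => by rw [hbits]
  have hround : Feasible InputSymbol fun N (p : α × List R) => _root_.updateValues
      (_root_.featureWeights (V N p.1) c (bits N p.1)) (gates N p.1) p.2 :=
    updateValues (hweights.comp id.fst) (hgates.comp id.fst) (fun N p => hrows N p.1) id.snd
  have hzero : Feasible InputSymbol fun N a => (gates N a).map fun _ => (0 : R) :=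
    hgates.map (f := fun _ _ _ => (0 : R)) FeasibleRing.zero
  have houtputs : Feasible InputSymbol fun N a => (gates N a).map fun g =>
      (g.2.take N).head?.getD false :=
    hgates.map (f := fun N _ g => (g.2.take N).head?.getD false)
      (head?_getD false id.snd.snd (bool false))
  refine of_eq (houtputs.rowSum (iterate_with (f := fun N a => _root_.updateValues
      (_root_.featureWeights (V N a) c (bits N a)) (gates N a)) hround hzero)) fun N a => ?_
  rw [List.take_of_length_le (by
    rw [List.length_map, hgates_def, List.length_tail]; exact (Nat.sub_le ..).trans (hlength N a)),
    List.map_congr_left fun g hg => by rw [List.take_of_length_le (hrows N a g hg)]]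
  rfl

end Ring

theorem addTerm : Feasible InputSymbol fun _ (p : (ℤ × ℤ × ℤ × ℤ) × ℤ) =>
    _root_.addTerm p.1 p.2 := by
  have hsucc : Feasible InputSymbol fun _ (p : (ℤ × ℤ × ℤ × ℤ) × ℤ) => p.1.1 + 1 :=
    id.fst.fst.add FeasibleRing.one
  exact hsucc.pair ((id.fst.snd.fst.mul hsucc).pair
    ((id.fst.snd.snd.fst.mul (hsucc.add hsucc)).pair
      ((id.fst.snd.snd.snd.mul (hsucc.add hsucc)).add (id.snd.mul id.fst.snd.fst))))

theorem trimDigits {l : ℕ → α → List Bool} (hl : Feasible InputSymbol l) :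
    Feasible InputSymbol fun N a => _root_.trimDigits ((l N a).take N) := by
  have hpush : Feasible InputSymbol fun _ (p : (α × Bool × List Bool) × Bool) =>
      pushDigit p.1.2 p.2 :=
    (id.fst.snd.fst.or id.snd).pair
      ((id.fst.snd.fst.or id.snd).cond (id.snd.cons' id.fst.snd.snd) id.fst.snd.snd)
  exact (hl.foldl (step := fun _ _ => pushDigit) ((bool false).pair nil) hpush).snd

theorem digits {z : ℕ → α → ℤ} (hz : Feasible InputSymbol z) :
    Feasible InputSymbol fun N a => (_root_.trimDigits (Layout.bits N (z N a))).map
      InputSymbol.bit := by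
  have hdigits : Feasible InputSymbol fun N a => _root_.trimDigits (Layout.bits N (z N a)) :=
    of_eq hz.bits.trimDigits fun N a => by rw [List.take_of_length_le (length_bits ..).le]
  have hbit : Feasible InputSymbol fun _ (p : α × Bool) => InputSymbol.bit p.2 :=
    of_eq (id.snd.cond (letter (.bit true)) (letter (.bit false))) fun _ p => by cases p.2 <;> rfl
  exact hdigits.map (f := fun _ _ => InputSymbol.bit) hbit

theorem writeFraction {r : ℕ → α → ℤ × ℤ} (hr : Feasible InputSymbol r) :
    Feasible InputSymbol fun N a => _root_.writeFraction N (r N a) := by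
  have hsign : Feasible InputSymbol fun N a => (Layout.bits N (r N a).1).head?.getD false :=
    of_eq (head?_getD false hr.fst.bits (bool false)) fun N a => by
      rw [List.take_of_length_le (length_bits ..).le]
  have hsymbol : Feasible InputSymbol fun N a =>
      InputSymbol.bit ((Layout.bits N (r N a).1).head?.getD false) :=
    of_eq (hsign.cond (letter (.bit true)) (letter (.bit false))) fun N a => by
      cases (Layout.bits N (r N a).1).head?.getD false <;> rfl
  exact hsymbol.cons' ((hsign.cond (FeasibleRing.zero.sub hr.fst) hr.fst).digits.append
    ((letter .endEntity).cons' hr.snd.digits))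

end Feasible

theorem feasible_shapFraction :
    Feasible InputSymbol fun N (l : List InputSymbol) => shapFraction N (l.take N) := by
  set p : ℕ → List InputSymbol → Polynomial ℤ := fun N l =>
    outputValue N .X true (l.take N) - outputValue N .X false (l.take N)
  have hX : Feasible InputSymbol fun _ (_ : List InputSymbol) => (Polynomial.X : Polynomial ℤ) :=
    Feasible.of_eq (f := fun _ _ => Polynomial.X * 1) FeasibleRing.one.X_mul fun _ _ => mul_one _
  have hp : Feasible InputSymbol p :=
    (hX.outputValue true Feasible.id).sub (hX.outputValue false Feasible.id)
  have hterms : Feasible InputSymbol fun N l => ((coeffs N (p N l)).zip (l.take N)).map Prod.fst :=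
    (hp.coeffs.zip Feasible.id.take).map (f := fun _ _ => Prod.fst) Feasible.id.snd.fst
  have hstart : Feasible InputSymbol fun _ (_ : List InputSymbol) => ((0 : ℤ), (1 : ℤ), (1 : ℤ),
      (0 : ℤ)) :=
    FeasibleRing.zero.pair (FeasibleRing.one.pair (FeasibleRing.one.pair FeasibleRing.zero))
  have hsum : Feasible InputSymbol fun N l =>
      ((((coeffs N (p N l)).zip (l.take N)).map Prod.fst).take N).foldl addTerm (0, 1, 1, 0) :=
    hterms.foldl (step := fun _ _ => addTerm) hstart
      (Feasible.addTerm.comp (Feasible.id.fst.snd.pair Feasible.id.snd))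
  refine (hsum.snd.snd.snd.pair hsum.snd.snd.fst).writeFraction.of_eq fun N l => ?_
  rw [List.take_of_length_le (by simp [coeffs])]
  rfl

/-! ### Correctness of the algorithm -/

/-- The numerator of `∑ k ∈ Finset.range n, f k / ((k + 1) * 2 ^ (k + 1))` over the denominator
`n.factorial * 2 ^ n`. -/
def fractionNumerator (f : ℕ → ℤ) : ℕ → ℤ
  | 0 => 0
  | n + 1 => fractionNumerator f n * ((n + 1) + (n + 1)) + f n * n.factorial

theorem foldl_addTerm (f : ℕ → ℤ) (n : ℕ) :
    ((List.range n).map f).foldl addTerm (0, 1, 1, 0) =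
      ((n : ℤ), (n.factorial : ℤ), ((n.factorial * 2 ^ n : ℕ) : ℤ), fractionNumerator f n) := by
  induction n with
  | zero => rfl
  | succ n ih =>
    rw [List.range_succ, List.map_append, List.foldl_append, ih]
    refine Prod.ext (by simp [addTerm]) (Prod.ext ?_ (Prod.ext ?_ rfl))
    · simp only [List.map_cons, List.map_nil, List.foldl_cons, List.foldl_nil, addTerm,
        Nat.factorial_succ]
      push_cast
      ring
    · simp only [List.map_cons, List.map_nil, List.foldl_cons, List.foldl_nil, addTerm,
        Nat.factorial_succ]
      push_cast
      ring

theorem fractionNumerator_div (f : ℕ → ℤ) (n : ℕ) :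
    (fractionNumerator f n : ℚ) / ((n.factorial * 2 ^ n : ℕ) : ℚ) =
      ∑ k ∈ Finset.range n, (f k : ℚ) / ((k + 1) * 2 ^ (k + 1)) := by
  induction n with
  | zero => simp [fractionNumerator]
  | succ n ih =>
    have hfactorial : (n.factorial : ℚ) ≠ 0 := by exact_mod_cast n.factorial_ne_zero
    rw [Finset.sum_range_succ, ← ih, fractionNumerator, Nat.factorial_succ]
    push_cast
    field_simp
    ring

theorem foldl_pushDigit_bits {N m : ℕ} (hm : m < 2 ^ N) :
    (bits N m).foldl pushDigit (false, []) = (decide (0 < m), m.bits) := by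
  induction N generalizing m with
  | zero =>
    obtain rfl : m = 0 := by simpa using hm
    rfl
  | succ N ih =>
    obtain ⟨b, n, rfl⟩ : ∃ b n, m = Nat.bit b n := ⟨m.bodd, m.div2, (Nat.bit_bodd_div2 m).symm⟩
    have hn : n < 2 ^ N := by
      rw [pow_succ] at hm
      cases b <;> simp only [Nat.bit, cond_true, cond_false] at hm <;> omega
    have hbits : bits (N + 1) (Nat.bit b n : ℕ) = bits N n ++ [b] := by
      rw [bits]
      congr 2
      · cases b <;> simp only [Nat.bit, cond_true, cond_false] <;> omega
      · cases b <;> simp [Nat.bit]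
    rw [hbits, List.foldl_append, ih hn, List.foldl_cons, List.foldl_nil, pushDigit]
    cases b
    · rcases n.eq_zero_or_pos with rfl | hpos
      · rfl
      · rw [Nat.bits_append_bit _ _ fun h => absurd h hpos.ne']
        simp [hpos]
    · rw [Nat.bits_append_bit _ _ fun _ => rfl]
      simp [Nat.bit]

theorem trimDigits_bits {N m : ℕ} (hm : m < 2 ^ N) : trimDigits (bits N m) = m.bits := by
  rw [trimDigits, foldl_pushDigit_bits hm]

/-- The output symbol for which a symbol of the algorithm stands. -/
def outputSymbol : InputSymbol → Option Bool
  | .bit b => some b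
  | _ => none

theorem map_writeFraction {N : ℕ} {r : ℤ × ℕ} (h₁ : |r.1| < 2 ^ N) (h₂ : r.2 < 2 ^ N) :
    (writeFraction (N + 1) (r.1, (r.2 : ℤ))).map outputSymbol = encodeFraction r := by
  obtain ⟨p, q⟩ := r
  obtain ⟨hlower, hupper⟩ := abs_lt.1 h₁
  have hle : 2 ^ N ≤ 2 ^ (N + 1) := Nat.pow_le_pow_right two_pos N.le_succ
  have hsign : (bits (N + 1) p).head?.getD false = decide (p < 0) := by
    rw [head?_bits hlower.le hupper, Option.getD_some]
  have habs : (bif decide (p < 0) then 0 - p else p) = p.natAbs := by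
    rcases lt_or_ge p 0 with hp | hp
    · rw [decide_eq_true hp, cond_true]; omega
    · rw [decide_eq_false hp.not_gt, cond_false]; omega
  have hnum : p.natAbs < 2 ^ (N + 1) := by
    refine lt_of_lt_of_le ?_ hle
    zify
    exact h₁
  have hsymbol : outputSymbol ∘ InputSymbol.bit = some := rfl
  rw [writeFraction, encodeFraction]
  simp only [hsign, habs, trimDigits_bits hnum, trimDigits_bits (h₂.trans_le hle), List.map_cons,
    List.map_append, List.map_map, hsymbol]
  rfl

theorem length_encodeFraction_le {N : ℕ} {r : ℤ × ℕ} (h₁ : |r.1| < 2 ^ N) (h₂ : r.2 < 2 ^ N) :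
    (encodeFraction r).length ≤ 2 * N + 2 := by
  have hnum : r.1.natAbs.size ≤ N := Nat.size_le.2 (by zify; exact h₁)
  have hden : r.2.size ≤ N := Nat.size_le.2 h₂
  rw [← Nat.size_eq_bits_len] at hnum hden
  simp only [encodeFraction, List.length_cons, List.length_append, List.length_map]
  omega

section Rows

variable {R : Type} [CommRing R]

theorem rowSum_append {r r' : List Bool} {v v' : List R} (h : r.length = v.length) :
    rowSum (r ++ r') (v ++ v') = rowSum r v + rowSum r' v' := by
  rw [rowSum, List.zip_append h, List.map_append, List.sum_append, rowSum, rowSum]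

theorem rowProd_append {r r' : List Bool} {v v' : List R} (h : r.length = v.length) :
    rowProd (r ++ r') (v ++ v') = rowProd r v * rowProd r' v' := by
  rw [rowProd, List.zip_append h, List.map_append, List.prod_append, rowProd, rowProd]

theorem zip_ofFn {α β : Type*} {n : ℕ} (f : Fin n → α) (g : Fin n → β) :
    (List.ofFn f).zip (List.ofFn g) = List.ofFn fun i => (f i, g i) :=
  List.ext_getElem (by simp) fun i _ _ => by simp

theorem rowSum_ofFn {n : ℕ} (p : Fin n → Prop) [DecidablePred p] (v : Fin n → R) :
    rowSum (List.ofFn fun i => decide (p i)) (List.ofFn v) = ∑ i with p i, v i := by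
  rw [rowSum, zip_ofFn, List.map_ofFn, List.sum_ofFn, Finset.sum_filter]
  simp only [Function.comp_apply, Bool.cond_decide]

theorem rowProd_ofFn {n : ℕ} (p : Fin n → Prop) [DecidablePred p] (v : Fin n → R) :
    rowProd (List.ofFn fun i => decide (p i)) (List.ofFn v) = ∏ i with p i, v i := by
  rw [rowProd, zip_ofFn, List.map_ofFn, List.prod_ofFn, Finset.prod_filter]
  simp only [Function.comp_apply, Bool.cond_decide]

theorem featureWeights_flatMap (V : R) (c : Bool) (l : List (Bool × Bool)) :
    featureWeights V c (l.flatMap fun p => [p.1, p.2]) =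
      l.map fun p => featureWeight V c p.1 p.2 := by
  have hfoldr : (l.flatMap fun p => [p.1, p.2]).foldr (readFeature V c) (none, []) =
      (none, l.map fun p => featureWeight V c p.1 p.2) := by
    induction l with
    | nil => rfl
    | cons p l ih => rw [List.flatMap_cons, List.foldr_append, ih]; rfl
  rw [featureWeights, hfoldr]

end Rows

theorem splitRows_map_bit_append (row : List Bool) (l : List InputSymbol) :
    splitRows (row.map .bit ++ l) = (row ++ (splitRows l).1, (splitRows l).2) := by
  induction row with
  | nil => rfl
  | cons b row ih =>
    rw [List.map_cons, List.cons_append, splitRows, List.foldr_cons, ← splitRows, ih]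
    rfl

theorem splitRows_flatMap {gates : List (InputSymbol × List Bool)}
    (h : ∀ g ∈ gates, ∀ b, g.1 ≠ .bit b) :
    splitRows (gates.flatMap fun g => g.1 :: g.2.map .bit) = ([], gates) := by
  induction gates with
  | nil => rfl
  | cons g gates ih =>
    obtain ⟨s, row⟩ := g
    have hs : ∀ t, splitRow s t = ([], (s, t.1) :: t.2) := fun t => by
      cases s with
      | bit b => exact absurd rfl (h _ List.mem_cons_self b)
      | _ => rfl
    rw [List.flatMap_cons, List.cons_append, splitRows, List.foldr_cons, ← splitRows,
      splitRows_map_bit_append, ih fun g hg => h g (List.mem_cons_of_mem _ hg), hs, List.append_nil]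

namespace BoolCircuit

open Classical in
/-- The number of gates from which there is a nonempty path to a gate. The value of a gate is
correct after more rounds of updates than its rank. -/
noncomputable def rank {X : Type} (C : BoolCircuit X) (g : Fin C.size) : ℕ :=
  (Finset.univ.filter fun h => Relation.TransGen C.Wire h g).card

theorem rank_lt_rank {X : Type} {C : BoolCircuit X} {h g : Fin C.size} (hg : h ∈ C.inputs g) :
    C.rank h < C.rank g := by
  classical
  refine Finset.card_lt_card (Finset.ssubset_iff_of_subset (fun i hi => ?_) |>.2 ⟨h, ?_, ?_⟩)
  · simp only [Finset.mem_filter, Finset.mem_univ, true_and] at hi ⊢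
    exact hi.tail hg
  · simpa only [Finset.mem_filter, Finset.mem_univ, true_and] using
      Relation.TransGen.single (r := C.Wire) hg
  · rw [Finset.mem_filter, not_and]
    exact fun _ => C.acyclic h

theorem rank_lt_size {X : Type} {C : BoolCircuit X} (g : Fin C.size) : C.rank g < C.size := by
  classical
  refine (Finset.card_lt_univ_of_notMem (x := g) ?_).trans_eq (Fintype.card_fin _)
  rw [Finset.mem_filter, not_and]
  exact fun _ => C.acyclic g

variable {n : ℕ} (C : BoolCircuit (Fin n))

/-- The kinds and the rows of the gates, as they are written in the input. -/
def gates : List (InputSymbol × List Bool) :=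
  List.ofFn fun g => ((C.label g).symbol, decide (g = C.output) ::
    ((List.ofFn fun y => decide (C.label g = .var y)) ++
      List.ofFn fun h => decide (h ∈ C.inputs g)))

variable {C} {R : Type} [CommRing R]

theorem gateValue_eq_modelCount (hdet : C.Deterministic) (hdec : C.Decomposable) (w : Fin n → R)
    (v : Fin C.size → R) (g : Fin C.size) (hv : ∀ h ∈ C.inputs g, v h = C.modelCount w h) :
    gateValue (C.label g).symbol ((List.ofFn fun y => decide (C.label g = .var y)) ++
      List.ofFn fun h => decide (h ∈ C.inputs g)) (List.ofFn w ++ List.ofFn v) =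
        C.modelCount w g := by
  set row : List Bool := (List.ofFn fun y => decide (C.label g = .var y)) ++
    List.ofFn fun h => decide (h ∈ C.inputs g)
  have hsum : rowSum row (List.ofFn w ++ List.ofFn v) =
      (∑ y with C.label g = .var y, w y) + ∑ h ∈ C.inputs g, C.modelCount w h := by
    rw [rowSum_append (by simp), rowSum_ofFn, rowSum_ofFn, Finset.filter_mem_eq_inter,
      Finset.univ_inter, Finset.sum_congr rfl hv]
  have hprod : rowProd row (List.ofFn w ++ List.ofFn v) =
      (∏ y with C.label g = .var y, w y) * ∏ h ∈ C.inputs g, C.modelCount w h := by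
    rw [rowProd_append (by simp), rowProd_ofFn, rowProd_ofFn, Finset.filter_mem_eq_inter,
      Finset.univ_inter, Finset.prod_congr rfl hv]
  have hsource : (C.label g).IsSource → C.inputs g = ∅ := (C.source_iff g).2
  cases h : C.label g with
  | var x =>
    refine hsum.trans ?_
    rw [modelCount_var h, hsource (by rw [h]; trivial), h]
    simp [Finset.filter_eq]
  | const b =>
    rw [modelCount_const h]
    cases b
    · refine hsum.trans ?_
      rw [hsource (by rw [h]; trivial), h]
      simp
    · refine hprod.trans ?_
      rw [hsource (by rw [h]; trivial), h]
      simp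
  | and =>
    refine hprod.trans ?_
    rw [modelCount_and hdec h, h]
    simp
  | or =>
    refine hsum.trans ?_
    rw [modelCount_or hdet h, h]
    simp
  | not =>
    refine (congrArg (1 - ·) hsum).trans ?_
    rw [modelCount_not h, h]
    simp

theorem iterate_updateValues (hdet : C.Deterministic) (hdec : C.Decomposable) (w : Fin n → R)
    (v₀ : Fin C.size → R) (k : ℕ) : ∃ v : Fin C.size → R,
      (updateValues (List.ofFn w) C.gates)^[k] (List.ofFn v₀) = List.ofFn v ∧
        ∀ g, C.rank g < k → v g = C.modelCount w g := by
  induction k with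
  | zero => exact ⟨v₀, rfl, fun g hg => absurd hg (Nat.not_lt_zero _)⟩
  | succ k ih =>
    obtain ⟨v, hv, hcorrect⟩ := ih
    refine ⟨_, by rw [Function.iterate_succ_apply', hv, updateValues, gates, List.map_ofFn],
      fun g hg => ?_⟩
    exact gateValue_eq_modelCount hdet hdec w v g fun h hh =>
      hcorrect h ((rank_lt_rank hh).trans_le (Nat.lt_succ_iff.1 hg))

end BoolCircuit

namespace ShapInput

variable (i : ShapInput)

/-- The bits of the entity, each with the mark for the given feature. -/
def markedEntity : List (Bool × Bool) :=
  List.ofFn fun y : Fin i.numFeatures => (i.entity y, decide (y = i.feature))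

theorem encode_eq : i.encode = (i.markedEntity.flatMap fun p => [p.1, p.2]).map .bit ++
    ((InputSymbol.endEntity, []) :: i.circuit.gates).flatMap fun g => g.1 :: g.2.map .bit := by
  rw [encode, markedEntity, List.flatMap_def, List.flatMap_cons, List.flatMap_def,
    BoolCircuit.gates, List.map_ofFn, List.map_ofFn, List.map_flatten, List.map_ofFn]
  simp [BoolCircuit.encodeGate, Function.comp_def, List.map_ofFn]

theorem splitRows_encode : splitRows i.encode =
    (i.markedEntity.flatMap fun p => [p.1, p.2], (.endEntity, []) :: i.circuit.gates) := by
  have hsymbol : ∀ g ∈ (InputSymbol.endEntity, []) :: i.circuit.gates, ∀ b, g.1 ≠ .bit b := by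
    rintro g (_ | ⟨_, hg⟩) b
    · simp
    · obtain ⟨g, rfl⟩ := List.mem_ofFn.1 hg
      dsimp only
      cases i.circuit.label g <;> simp [GateLabel.symbol]
  rw [encode_eq, splitRows_map_bit_append, splitRows_flatMap hsymbol, List.append_nil]

theorem featureWeights_markedEntity {R : Type} [CommRing R] (V : R) (c : Bool) :
    featureWeights V c (i.markedEntity.flatMap fun p => [p.1, p.2]) =
      List.ofFn (agreementWeight V i.entity i.feature c) := by
  rw [featureWeights_flatMap, markedEntity, List.map_ofFn]
  congr 1
  funext y
  cases hy : decide (y = i.feature) <;> cases he : i.entity y <;> cases c <;>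
    simp_all [featureWeight, agreementWeight]

theorem outputValue_encode {R : Type} [CommRing R] {N : ℕ} (hN : i.circuit.size ≤ N) (V : R)
    (c : Bool) : outputValue N V c i.encode =
      weightedCount (agreementWeight V i.entity i.feature c)
        fun e => if i.circuit.classifier e then 1 else 0 := by
  obtain ⟨v, hv, hcorrect⟩ := BoolCircuit.iterate_updateValues i.deterministic i.decomposable
    (agreementWeight V i.entity i.feature c) (fun _ => 0) N
  have hzero : (i.circuit.gates.map fun _ => (0 : R)) = List.ofFn fun _ => 0 := List.map_ofFn ..
  have houtput : (i.circuit.gates.map fun g => g.2.head?.getD false) =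
      List.ofFn fun g => decide (g = i.circuit.output) := List.map_ofFn ..
  rw [outputValue, splitRows_encode]
  dsimp only [List.tail_cons]
  rw [featureWeights_markedEntity, hzero, houtput, hv, rowSum_ofFn, Finset.filter_eq',
    if_pos (Finset.mem_univ _), Finset.sum_singleton,
    hcorrect _ ((BoolCircuit.rank_lt_size _).trans_le hN)]
  rfl

theorem length_encode : i.encode.length =
    2 * i.numFeatures + 1 + i.circuit.size * (2 + i.numFeatures + i.circuit.size) := by
  simp only [encode, BoolCircuit.encodeGate, List.length_append, List.length_flatten, List.map_ofFn,
    comp_def, List.length_cons, List.length_nil, zero_add, Nat.reduceAdd, List.ofFn_const,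
    List.sum_replicate, smul_eq_mul, List.length_ofFn]
  ring

theorem five_le_length_encode : 5 ≤ i.encode.length := by
  have hn : 0 < i.numFeatures := i.feature.pos
  have hm : 0 < i.circuit.size := i.circuit.output.pos
  rw [length_encode]
  nlinarith

theorem numFeatures_lt_length_encode : i.numFeatures < i.encode.length := by
  rw [length_encode]
  omega

theorem size_circuit_le_length_encode : i.circuit.size ≤ i.encode.length := by
  rw [length_encode]
  nlinarith

/-- The polynomial whose `halfIntegral` is the score. -/
noncomputable def scorePolynomial : Polynomial ℤ :=
  weightedCount (agreementWeight .X i.entity i.feature true)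
      (fun e => if i.circuit.classifier e then 1 else 0) -
    weightedCount (agreementWeight .X i.entity i.feature false)
      (fun e => if i.circuit.classifier e then 1 else 0)

theorem natDegree_scorePolynomial_lt : i.scorePolynomial.natDegree < i.encode.length := by
  have hdegree : ∀ c, (weightedCount (agreementWeight Polynomial.X i.entity i.feature c)
      fun e => if i.circuit.classifier e then (1 : Polynomial ℤ) else 0).natDegree ≤
        i.numFeatures := fun c =>
    (natDegree_weightedCount_le (natDegree_agreementWeight_le _ _ c) _).trans_eq
      (Fintype.card_fin _)
  exact (Polynomial.natDegree_sub_le_of_le (hdegree true) (hdegree false)).trans_lt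
    (by simpa using i.numFeatures_lt_length_encode)

/-- The fraction that the algorithm computes. -/
noncomputable def scoreFraction : ℤ × ℕ :=
  (fractionNumerator i.scorePolynomial.coeff i.encode.length,
    i.encode.length.factorial * 2 ^ i.encode.length)

theorem scoreFraction_snd_pos : 0 < i.scoreFraction.2 := by
  unfold scoreFraction
  positivity

theorem SHAP_eq_scoreFraction : SHAP i.circuit.classifier i.entity i.feature =
    (i.scoreFraction.1 : ℚ) / i.scoreFraction.2 := by
  rw [SHAP_eq_halfIntegral, ← scorePolynomial, halfIntegral_eq_sum i.natDegree_scorePolynomial_lt,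
    scoreFraction, fractionNumerator_div]

theorem abs_scoreFraction_fst_le : |i.scoreFraction.1| ≤ i.scoreFraction.2 := by
  have hpos : (0 : ℚ) < i.scoreFraction.2 := by exact_mod_cast i.scoreFraction_snd_pos
  have hle := abs_SHAP_le_one i.circuit.classifier i.entity i.feature
  rw [SHAP_eq_scoreFraction, abs_div, abs_of_pos hpos, div_le_one hpos] at hle
  exact_mod_cast hle

theorem scoreFraction_snd_lt :
    i.scoreFraction.2 < 2 ^ (i.encode.length ^ 2 + i.encode.length + 1) := by
  set L := i.encode.length
  have hfactorial : L.factorial ≤ 2 ^ L ^ 2 := calc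
    L.factorial ≤ L ^ L := L.factorial_le_pow
    _ ≤ (2 ^ L) ^ L := Nat.pow_le_pow_left Nat.lt_two_pow_self.le L
    _ = 2 ^ L ^ 2 := by rw [← pow_mul, sq]
  calc L.factorial * 2 ^ L ≤ 2 ^ L ^ 2 * 2 ^ L := Nat.mul_le_mul_right _ hfactorial
    _ = 2 ^ (L ^ 2 + L) := (pow_add ..).symm
    _ < 2 ^ (L ^ 2 + L + 1) := Nat.pow_lt_pow_succ one_lt_two

theorem shapFraction_encode {N : ℕ} (hN : i.encode.length ≤ N) :
    shapFraction N i.encode = writeFraction N (i.scoreFraction.1, (i.scoreFraction.2 : ℤ)) := by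
  have hsize := i.size_circuit_le_length_encode.trans hN
  have hterms : ((coeffs N i.scorePolynomial).zip i.encode).map Prod.fst =
      (List.range i.encode.length).map i.scorePolynomial.coeff := by
    refine List.ext_getElem (by simpa [coeffs] using hN) fun k _ _ => ?_
    simp [coeffs]
  rw [shapFraction, outputValue_encode i hsize, outputValue_encode i hsize, ← scorePolynomial]
  rw [hterms, foldl_addTerm]
  rfl

theorem map_shapFraction_encode :
    ((shapFraction (i.encode.length ^ 3) (i.encode.take (i.encode.length ^ 3))).take
      (i.encode.length ^ 3)).map outputSymbol = encodeFraction i.scoreFraction := by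
  set L := i.encode.length
  have hL5 : 5 ≤ L := i.five_le_length_encode
  have hLN : L ≤ L ^ 3 := Nat.le_self_pow three_ne_zero L
  have hN : 2 * (L ^ 2 + L + 1) + 2 ≤ L ^ 3 := by nlinarith [sq_nonneg L]
  have hden := i.scoreFraction_snd_lt
  have hnum : |i.scoreFraction.1| < 2 ^ (L ^ 2 + L + 1) :=
    i.abs_scoreFraction_fst_le.trans_lt (by exact_mod_cast hden)
  obtain ⟨N, hN'⟩ : ∃ N, L ^ 3 = N + 1 := ⟨L ^ 3 - 1, by omega⟩
  have hexp : L ^ 2 + L + 1 ≤ N := by omega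
  rw [List.take_of_length_le hLN, i.shapFraction_encode hLN, List.map_take, hN',
    map_writeFraction (hnum.trans_le (pow_le_pow_right₀ one_le_two hexp))
      (hden.trans_le (pow_le_pow_right₀ one_le_two hexp)), ← hN']
  exact List.take_of_length_le ((length_encodeFraction_le hnum hden).trans hN)

end ShapInput

/-- There is a polynomial-time Turing machine which, given a deterministic and decomposable Boolean
circuit, an entity and a feature, outputs the SHAP-score as a fraction `p / q` of integers. -/
theorem mainTheorem1 :
    ∃ f : ShapInput → ℤ × ℕ,
      Nonempty (Turing.TM2ComputableInPolyTime ShapInput.encode encodeFraction f) ∧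
      ∀ i : ShapInput, 0 < (f i).2 ∧
        SHAP i.circuit.classifier i.entity i.feature = ((f i).1 : ℚ) / ((f i).2 : ℚ) :=
  ⟨ShapInput.scoreFraction,
    feasible_shapFraction.nonempty_tm2ComputableInPolyTime three_ne_zero
      ShapInput.map_shapFraction_encode,
    fun i => ⟨i.scoreFraction_snd_pos, i.SHAP_eq_scoreFraction⟩⟩
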